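/- **Notation.** Let $\Omega\subset\mathbb{R}^3$ be a bounded domain (nonempty, open, connected) with connected Lipschitz boundary. Let $C^\infty_{c,\sigma}(\Omega)$ be the set of smooth divergence-free vector fields $\Omega\to\mathbb{R}^3$ with compact support in $\Omega$. Let $H^1_0(\Omega)$ be the closure of the smooth compactly supported vector fields in the norm $\|f\|_{H^1}=\big(\int_\Omega|\nabla f|^2+\tfrac12|f|^2\big)^{1/2}$, and let $X=H^1_{0,\sigma}(\Omega)=\{f\in H^1_0(\Omega):\operatorname{div} f=0\}$ with the same norm. Let $U_0:\Omega\to\mathbb{R}^3$ be a vector field with a weak gradient, such that $$U_0\in L^6(\Omega),\qquad \nabla U_0\in L^2(\Omega),\qquad \Big|\int_\Omega F_0\cdot\eta\Big|\le C\quad\text{for all }\eta\in X\text{ with }\|\eta\|_{H^1}\le 1,$$ for some constant $C$, where $F_0=\Delta U_0+(U_0+x\cdot\nabla U_0)-U_0\cdot\nabla U_0$ and the term with $\Delta U_0$ is understood weakly, that is $$\int_\Omega F_0\cdot\eta:=-\int_\Omega\nabla U_0:\nabla\eta+\int_\Omega\big(U_0+x\cdot\nabla U_0-U_0\cdot\nabla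 U_0\big)\cdot\eta .$$ For $V\in X$ put $F_1(V)=-(U_0+V)\cdot\nabla V-V\cdot\nabla U_0$ and $G(V)=V+x\cdot\nabla V+F_0+F_1(V)$. **Theorem (Compactness).** For every $V\in X$ there is exactly one element $T(G(V))\in X$ such that $$\int_\Omega\nabla T(G(V)):\nabla\zeta=\int_\Omega G(V)\cdot\zeta\qquad\text{for all }\zeta\in C^\infty_{c,\sigma}(\Omega),$$ and the map $S:X\to X$, $S(V)=T(G(V))$, is continuous and compact, i.e. it maps every bounded subset of $X$ to a relatively compact subset of $X$. -/

import Mathlib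

open MeasureTheory
open scoped ContDiff

noncomputable section

namespace Leray

/-- Euclidean three-space. -/
abbrev Vec : Type := EuclideanSpace ℝ (Fin 3)

/-- Values of gradients of vector fields: `A j` is the `j`-th partial derivative (a vector).
The norm is the Frobenius norm and `inner ℝ A B = ∑ j, ⟪A j, B j⟫`. -/
abbrev Grad : Type := PiLp 2 (fun _ : Fin 3 => Vec)

/-- Classical partial derivative in the direction of the `j`-th coordinate. -/
def pderiv {F : Type*} [NormedAddCommGroup F] [NormedSpace ℝ F]
    (f : Vec → F) (j : Fin 3) (x : Vec) : F :=
  fderiv ℝ f x (EuclideanSpace.single j 1)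

/-- Classical gradient of a vector field. -/
def classicalGrad (f : Vec → Vec) (x : Vec) : Grad :=
  WithLp.toLp 2 (fun j => pderiv f j x)

/-- The trace of a gradient: `traceGrad (∇ f) = div f`. -/
def traceGrad (A : Grad) : ℝ := ∑ j, A j j

/-- `(a · ∇) f` at a point where `∇ f` has the value `A`. -/
def convect (a : Vec) (A : Grad) : Vec := ∑ j, a j • A j

/-- `f ∈ C_c^∞(Ω; F)`. -/
structure IsTest {F : Type*} [NormedAddCommGroup F] [NormedSpace ℝ F]
    (Ω : Set Vec) (f : Vec → F) : Prop where
  smooth : ContDiff ℝ ∞ f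
  compact : HasCompactSupport f
  support : tsupport f ⊆ Ω

/-- `ζ ∈ C_{c,σ}^∞(Ω)`: divergence-free test fields. -/
structure IsSolenoidalTest (Ω : Set Vec) (ζ : Vec → Vec) : Prop where
  test : IsTest Ω ζ
  div_eq_zero : ∀ x, traceGrad (classicalGrad ζ x) = 0

/-- `Du` is the weak (distributional) gradient of `u` in `Ω`. -/
structure HasWeakGrad (Ω : Set Vec) (u : Vec → Vec) (Du : Vec → Grad) : Prop where
  locInt : LocallyIntegrableOn u Ω
  locInt_grad : LocallyIntegrableOn Du Ω
  byParts : ∀ φ : Vec → ℝ, IsTest Ω φ → ∀ j : Fin 3,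
    ∫ x in Ω, pderiv φ j x • u x = - ∫ x in Ω, φ x • Du x j

/-- Lipschitz boundary: near each boundary point, after an orthogonal change of coordinates,
`Ω` is the region strictly above the graph of a Lipschitz function of two variables. -/
def HasLipschitzBoundary (Ω : Set Vec) : Prop :=
  ∀ x₀ ∈ frontier Ω, ∃ r : ℝ, 0 < r ∧ ∃ R : Vec ≃ₗᵢ[ℝ] Vec,
    ∃ K : NNReal, ∃ γ : EuclideanSpace ℝ (Fin 2) → ℝ, LipschitzWith K γ ∧
      ∀ x ∈ Metric.ball x₀ r, (x ∈ Ω ↔ γ !₂[R x 0, R x 1] < R x 2)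

/-- A bounded domain with connected Lipschitz boundary. -/
structure IsBoundedLipschitzDomain (Ω : Set Vec) : Prop where
  isOpen : IsOpen Ω
  connected : IsConnected Ω
  bounded : Bornology.IsBounded Ω
  boundary_connected : IsConnected (frontier Ω)
  boundary_lipschitz : HasLipschitzBoundary Ω

/-- Pairs `(v, ∇ v)` of square integrable classes over `Ω`. -/
abbrev L2Pair (Ω : Set Vec) : Type :=
  Lp Vec 2 (volume.restrict Ω) × Lp Grad 2 (volume.restrict Ω)

lemma pderiv_add {f g : Vec → Vec} (hf : ContDiff ℝ ∞ f) (hg : ContDiff ℝ ∞ g)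
    (j : Fin 3) (x : Vec) : pderiv (f + g) j x = pderiv f j x + pderiv g j x := by
  have h1 : DifferentiableAt ℝ f x := (hf.differentiable (by simp)).differentiableAt
  have h2 : DifferentiableAt ℝ g x := (hg.differentiable (by simp)).differentiableAt
  simp [pderiv, fderiv_add h1 h2]

lemma pderiv_smul {f : Vec → Vec} (hf : ContDiff ℝ ∞ f) (c : ℝ)
    (j : Fin 3) (x : Vec) : pderiv (c • f) j x = c • pderiv f j x := by
  have h1 : DifferentiableAt ℝ f x := (hf.differentiable (by simp)).differentiableAt
  simp [pderiv, fderiv_const_smul h1 c]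

lemma classicalGrad_add {f g : Vec → Vec} (hf : ContDiff ℝ ∞ f) (hg : ContDiff ℝ ∞ g)
    (x : Vec) : classicalGrad (f + g) x = classicalGrad f x + classicalGrad g x := by
  ext j : 1
  exact pderiv_add hf hg j x

lemma classicalGrad_smul {f : Vec → Vec} (hf : ContDiff ℝ ∞ f) (c : ℝ)
    (x : Vec) : classicalGrad (c • f) x = c • classicalGrad f x := by
  ext j : 1
  exact pderiv_smul hf c j x

/-- The pairs `(φ, ∇ φ)` with `φ ∈ C_c^∞(Ω; ℝ³)`. -/
def testPairs (Ω : Set Vec) : Submodule ℝ (L2Pair Ω) where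
  carrier := {p | ∃ φ : Vec → Vec, IsTest Ω φ ∧
    p.1 =ᵐ[volume.restrict Ω] φ ∧ p.2 =ᵐ[volume.restrict Ω] classicalGrad φ}
  zero_mem' := by
    refine ⟨0, ⟨contDiff_const, HasCompactSupport.zero, by simp [tsupport]⟩,
      Lp.coeFn_zero _ _ _, ?_⟩
    filter_upwards [Lp.coeFn_zero Grad 2 (volume.restrict Ω)] with x hx
    rw [Prod.snd_zero, hx]
    ext j : 1
    simp [classicalGrad, pderiv]
  add_mem' := by
    rintro p q ⟨φ, hφ, h1, h2⟩ ⟨ψ, hψ, h3, h4⟩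
    refine ⟨φ + ψ, ⟨hφ.smooth.add hψ.smooth, hφ.compact.add hψ.compact,
      (tsupport_add φ ψ).trans (Set.union_subset hφ.support hψ.support)⟩, ?_, ?_⟩
    · exact (Lp.coeFn_add p.1 q.1).trans (h1.add h3)
    · filter_upwards [Lp.coeFn_add p.2 q.2, h2, h4] with x hx h2 h4
      rw [Prod.snd_add, hx, Pi.add_apply, h2, h4, classicalGrad_add hφ.smooth hψ.smooth]
  smul_mem' := by
    rintro c p ⟨φ, hφ, h1, h2⟩
    refine ⟨c • φ, ⟨contDiff_const.smul hφ.smooth, hφ.compact.smul_left (f := fun _ => c),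
      (closure_mono (Function.support_const_smul_subset c φ)).trans hφ.support⟩, ?_, ?_⟩
    · exact (Lp.coeFn_smul c p.1).trans (h1.const_smul c)
    · filter_upwards [Lp.coeFn_smul c p.2, h2] with x hx h2
      rw [Prod.smul_snd, hx, Pi.smul_apply, h2, classicalGrad_smul hφ.smooth]

/-- `H^1_0(Ω; ℝ³)`, the closure of the test fields in the `H^1` topology.  An element is recorded
as the pair `(v, ∇ v)`; the second entry, a limit of gradients of test fields in `L²`, is the weak
gradient of the first one. -/
def H10 (Ω : Set Vec) : Submodule ℝ (L2Pair Ω) := (testPairs Ω).topologicalClosure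

lemma traceGrad_add (A B : Grad) : traceGrad (A + B) = traceGrad A + traceGrad B := by
  simp [traceGrad, Finset.sum_add_distrib]

lemma traceGrad_smul (c : ℝ) (A : Grad) : traceGrad (c • A) = c * traceGrad A := by
  simp [traceGrad, Finset.mul_sum]

/-- `H^1_{0,σ}(Ω) = {f ∈ H^1_0(Ω) : div f = 0}`. -/
def H10sigma (Ω : Set Vec) : Submodule ℝ (L2Pair Ω) where
  carrier := {p | p ∈ H10 Ω ∧ ∀ᵐ x ∂(volume.restrict Ω), traceGrad (p.2 x) = 0}
  zero_mem' := by
    refine ⟨zero_mem _, ?_⟩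
    filter_upwards [Lp.coeFn_zero Grad 2 (volume.restrict Ω)] with x hx
    rw [Prod.snd_zero, hx]
    simp [traceGrad]
  add_mem' := by
    rintro p q ⟨h1, h2⟩ ⟨h3, h4⟩
    refine ⟨add_mem h1 h3, ?_⟩
    filter_upwards [Lp.coeFn_add p.2 q.2, h2, h4] with x hx h2 h4
    rw [Prod.snd_add, hx, Pi.add_apply, traceGrad_add, h2, h4, add_zero]
  smul_mem' := by
    rintro c p ⟨h1, h2⟩
    refine ⟨Submodule.smul_mem _ c h1, ?_⟩
    filter_upwards [Lp.coeFn_smul c p.2, h2] with x hx h2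
    rw [Prod.smul_snd, hx, Pi.smul_apply, traceGrad_smul, h2, mul_zero]

/-- The space `X = H^1_{0,σ}(Ω)` as a type of its own (so that it does not inherit the maximum norm
of the product). -/
def X (Ω : Set Vec) : Type := ↥(H10sigma Ω)

namespace X

variable {Ω : Set Vec}

instance : AddCommGroup (X Ω) := inferInstanceAs (AddCommGroup ↥(H10sigma Ω))

instance : Module ℝ (X Ω) := inferInstanceAs (Module ℝ ↥(H10sigma Ω))

/-- The field `V` as an `L²` class. -/
def val (V : X Ω) : Lp Vec 2 (volume.restrict Ω) := V.1.1

/-- Its gradient `∇ V` as an `L²` class. -/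
def grad (V : X Ω) : Lp Grad 2 (volume.restrict Ω) := V.1.2

lemma val_add (V W : X Ω) : (V + W).val = V.val + W.val := rfl
lemma grad_add (V W : X Ω) : (V + W).grad = V.grad + W.grad := rfl
lemma val_smul (c : ℝ) (V : X Ω) : (c • V).val = c • V.val := rfl
lemma grad_smul (c : ℝ) (V : X Ω) : (c • V).grad = c • V.grad := rfl

lemma ext_val_grad {V W : X Ω} (h1 : V.val = W.val) (h2 : V.grad = W.grad) : V = W :=
  Subtype.ext (Prod.ext h1 h2)

/-- The inner product `∫ ∇V : ∇W + ½ ∫ V · W`, whose norm is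
`‖V‖ = (∫ |∇V|² + ½ |V|²)^{1/2}`. -/
@[reducible]
def core (Ω : Set Vec) : InnerProductSpace.Core ℝ (X Ω) where
  inner V W := inner ℝ V.grad W.grad + (1 / 2 : ℝ) * inner ℝ V.val W.val
  conj_inner_symm V W := by
    simp [real_inner_comm]
  re_inner_nonneg V := by
    have h1 : 0 ≤ inner ℝ V.grad V.grad := real_inner_self_nonneg
    have h2 : 0 ≤ inner ℝ V.val V.val := real_inner_self_nonneg
    simp only [RCLike.re_to_real]
    positivity
  add_left V W Z := by
    simp only [val_add, grad_add, inner_add_left]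
    ring
  smul_left V W c := by
    simp only [val_smul, grad_smul, real_inner_smul_left, conj_trivial]
    ring
  definite V h := by
    have h1 : 0 ≤ inner ℝ V.grad V.grad := real_inner_self_nonneg
    have h2 : 0 ≤ inner ℝ V.val V.val := real_inner_self_nonneg
    have h3 : inner ℝ V.grad V.grad = 0 := by linarith
    have h4 : inner ℝ V.val V.val = 0 := by linarith
    exact ext_val_grad (inner_self_eq_zero.mp h4) (inner_self_eq_zero.mp h3)

instance : NormedAddCommGroup (X Ω) := (core Ω).toNormedAddCommGroup

instance : InnerProductSpace ℝ (X Ω) := InnerProductSpace.ofCore (core Ω).toCore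

end X

/-- The pairing `∫_Ω F₀ · η` of `F₀ = Δ U₀ + (U₀ + x·∇U₀) - U₀·∇U₀` with a field `η` vanishing on
the boundary and having gradient `Dη`; the term `∫ Δ U₀ · η` is understood in the sense of
distributions, `- ∫ ∇U₀ : ∇η`. -/
def pairF0 (Ω : Set Vec) (U₀ : Vec → Vec) (DU₀ : Vec → Grad)
    (η : Vec → Vec) (Dη : Vec → Grad) : ℝ :=
  - (∫ x in Ω, inner ℝ (DU₀ x) (Dη x)) +
    ∫ x in Ω, inner ℝ (U₀ x + convect x (DU₀ x) - convect (U₀ x) (DU₀ x)) (η x)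

/-- The standing assumption on `U₀` (with weak gradient `DU₀`): `U₀ ∈ L⁶`, `∇U₀ ∈ L²`, and `F₀` is
bounded on the unit ball of `H^1_{0,σ}(Ω)`. -/
structure BoundaryData (Ω : Set Vec) (U₀ : Vec → Vec) (DU₀ : Vec → Grad) : Prop where
  weakGrad : HasWeakGrad Ω U₀ DU₀
  memL6 : MemLp U₀ 6 (volume.restrict Ω)
  grad_memL2 : MemLp DU₀ 2 (volume.restrict Ω)
  F0_bounded : ∃ C : ℝ, ∀ η : X Ω, ‖η‖ ≤ 1 → |pairF0 Ω U₀ DU₀ η.val η.grad| ≤ C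

/-- `F₁(V) = -(U₀ + V)·∇V - V·∇U₀`. -/
def F1 {Ω : Set Vec} (U₀ : Vec → Vec) (DU₀ : Vec → Grad) (V : X Ω) (x : Vec) : Vec :=
  - convect (U₀ x + V.val x) (V.grad x) - convect (V.val x) (DU₀ x)

/-- The pairing `∫_Ω G(V) · ζ` of `G(V) = V + x·∇V + F₀ + F₁(V)` with a test field `ζ`. -/
def pairG (Ω : Set Vec) (U₀ : Vec → Vec) (DU₀ : Vec → Grad) (V : X Ω) (ζ : Vec → Vec) : ℝ :=
  (∫ x in Ω, inner ℝ (V.val x + convect x (V.grad x) + F1 U₀ DU₀ V x) (ζ x)) +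
    pairF0 Ω U₀ DU₀ ζ (classicalGrad ζ)

/-- `W = T(f)`: the field `W ∈ X` satisfies `∫_Ω ∇W : ∇ζ = ⟨f, ζ⟩` for all `ζ ∈ C_{c,σ}^∞(Ω)`. -/
def IsStokesSolution (Ω : Set Vec) (f : (Vec → Vec) → ℝ) (W : X Ω) : Prop :=
  ∀ ζ : Vec → Vec, IsSolenoidalTest Ω ζ →
    ∫ x in Ω, inner ℝ (W.grad x) (classicalGrad ζ x) = f ζ

end Leray

end

noncomputable section

namespace Leray

open scoped ENNReal NNReal Convolution
open Filter Topology

/-! Existence. By Poincaré's inequality the Dirichlet form is coercive on X, so Lax–Milgram inverts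
it boundedly on the dual of X (`X.exists_stokes_solver`). It remains to read G(V) as a functional on
X. By Sobolev X embeds into L⁶, and Ω is bounded, so V + x·∇V + F₁(V) lies in L^{3/2} and depends
continuously on V, as a polynomial of degree two (`nonlinearity`). Such functions act on X because X
embeds into L³. The fixed term F₀ is an L^{3/2} function plus a pairing of gradients. Hence S is
continuous and maps bounded sets to bounded sets.

Compactness. Let u, v solve the problem with data g, g' in L^{3/2}, up to the common term F₀.
Testing the difference with u - v cancels F₀ and bounds ‖∇(u - v)‖₂² by ‖g - g'‖_{3/2} ‖u - v‖₃,
while ‖·‖₃² ≤ ‖·‖₂ ‖·‖₆. On a bounded family, closeness in L² therefore forces closeness in X. By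
Rellich (`exists_rellich`) closeness in L² is decided by finitely many linear functionals up to a
small error, so the family is totally bounded (`X.totallyBounded_of_dirichlet_eq`).

Uniqueness. The equation is tested only against smooth compactly supported solenoidal fields,
whereas X consists of all divergence-free elements of H¹₀, so density is needed
(`X.exists_norm_sub_ofTest_lt`). Mollifying the extension by zero preserves the zero divergence but
spreads the support beyond Ω. To bring it back, small shears along the local vertical directions of
the Lipschitz boundary are composed to a map that sends the complement of Ω off the closure of Ω.
Pulling fields back along it by the Piola transform keeps them solenoidal, is uniformly bounded in
H¹, and puts the support inside Ω. -/

/-- The gradient recorded by a total derivative. -/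
def gradOfFDeriv : (Vec →L[ℝ] Vec) →L[ℝ] Grad :=
  (PiLp.continuousLinearEquiv 2 ℝ (fun _ : Fin 3 => Vec)).symm.toContinuousLinearMap ∘L
    ContinuousLinearMap.pi fun j =>
      ContinuousLinearMap.apply ℝ Vec (EuclideanSpace.single j (1 : ℝ))

lemma gradOfFDeriv_apply (L : Vec →L[ℝ] Vec) (j : Fin 3) :
    gradOfFDeriv L j = L (EuclideanSpace.single j 1) := rfl

lemma classicalGrad_eq (f : Vec → Vec) (x : Vec) :
    classicalGrad f x = gradOfFDeriv (fderiv ℝ f x) := rfl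

lemma sum_smul_single (v : Vec) : ∑ j, v j • (EuclideanSpace.single j (1 : ℝ) : Vec) = v := by
  ext i
  simp [Finset.sum_apply, Pi.single_apply]

lemma norm_convect_le (a : Vec) (A : Grad) : ‖convect a A‖ ≤ ‖a‖ * ‖A‖ := by
  calc ‖convect a A‖ ≤ ∑ j, ‖a j‖ * ‖A j‖ := by
        refine (norm_sum_le _ _).trans (le_of_eq ?_)
        simp [norm_smul]
    _ ≤ √(∑ j, ‖a j‖ ^ 2) * √(∑ j, ‖A j‖ ^ 2) := Real.sum_mul_le_sqrt_mul_sqrt _ _ _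
    _ = ‖a‖ * ‖A‖ := by rw [EuclideanSpace.norm_eq, PiLp.norm_eq_of_L2]

/-- `(a · ∇) f` as a bounded bilinear map. -/
def convectL : Vec →L[ℝ] Grad →L[ℝ] Vec :=
  LinearMap.mkContinuous₂
    (LinearMap.mk₂ ℝ convect
      (fun a b A => by simp [convect, add_smul, Finset.sum_add_distrib])
      (fun c a A => by simp [convect, mul_smul, Finset.smul_sum])
      (fun a A B => by simp [convect, Finset.sum_add_distrib])
      (fun c a A => by simp [convect, Finset.smul_sum, smul_comm c])) 1
    (fun a A => by rw [one_mul]; exact norm_convect_le a A)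

lemma fderiv_apply_eq_convect (f : Vec → Vec) (x v : Vec) :
    fderiv ℝ f x v = convect v (classicalGrad f x) := by
  conv_lhs => rw [← sum_smul_single v]
  simp [convect, classicalGrad, pderiv]

/-- The operator norm is dominated by the Frobenius norm. This carries inequalities stated with
`fderiv` (Sobolev, Poincaré, mollification) over to the gradient norm of X. -/
lemma norm_fderiv_le_classicalGrad (f : Vec → Vec) (x : Vec) :
    ‖fderiv ℝ f x‖ ≤ ‖classicalGrad f x‖ :=
  ContinuousLinearMap.opNorm_le_bound _ (norm_nonneg _) fun v => by
    rw [fderiv_apply_eq_convect, mul_comm]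
    exact norm_convect_le _ _

/-- The trace of a gradient as a bounded linear functional. -/
def traceGradL : Grad →L[ℝ] ℝ :=
  ∑ j : Fin 3, (EuclideanSpace.proj j : Vec →L[ℝ] ℝ) ∘L PiLp.proj 2 (fun _ : Fin 3 => Vec) j

lemma traceGradL_apply (A : Grad) : traceGradL A = traceGrad A := by
  simp [traceGradL, traceGrad]

/-! ### Test functions: stability under derivatives and linear maps, integrability. -/

lemma IsTest.fderiv {F : Type*} [NormedAddCommGroup F] [NormedSpace ℝ F] {Ω : Set Vec}
    {f : Vec → F} (hf : IsTest Ω f) : IsTest Ω (fderiv ℝ f) where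
  smooth := hf.smooth.fderiv_right (by simp)
  compact := hf.compact.fderiv (𝕜 := ℝ)
  support := (tsupport_fderiv_subset ℝ).trans hf.support

lemma IsTest.clm_comp {F G : Type*} [NormedAddCommGroup F] [NormedSpace ℝ F]
    [NormedAddCommGroup G] [NormedSpace ℝ G] {Ω : Set Vec}
    {f : Vec → F} (hf : IsTest Ω f) (L : F →L[ℝ] G) : IsTest Ω (fun x => L (f x)) where
  smooth := L.contDiff.comp hf.smooth
  compact := hf.compact.comp_left (map_zero L)
  support := (tsupport_comp_subset (map_zero L) f).trans hf.support

lemma IsTest.classicalGrad {Ω : Set Vec} {f : Vec → Vec} (hf : IsTest Ω f) :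
    IsTest Ω (classicalGrad f) :=
  hf.fderiv.clm_comp gradOfFDeriv

lemma IsTest.memLp {F : Type*} [NormedAddCommGroup F] [NormedSpace ℝ F] {Ω : Set Vec}
    {f : Vec → F} (hf : IsTest Ω f) (p : ℝ≥0∞) (μ : Measure Vec) [IsFiniteMeasureOnCompacts μ] :
    MemLp f p μ :=
  hf.smooth.continuous.memLp_of_hasCompactSupport hf.compact

lemma IsTest.mono {F : Type*} [NormedAddCommGroup F] [NormedSpace ℝ F] {Ω Ω' : Set Vec}
    {f : Vec → F} (hf : IsTest Ω f) (h : Ω ⊆ Ω') : IsTest Ω' f :=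
  ⟨hf.smooth, hf.compact, hf.support.trans h⟩

lemma IsTest.eq_zero_of_notMem {F : Type*} [NormedAddCommGroup F] [NormedSpace ℝ F] {Ω : Set Vec}
    {f : Vec → F} (hf : IsTest Ω f) {x : Vec} (hx : x ∉ Ω) : f x = 0 :=
  image_eq_zero_of_notMem_tsupport fun h => hx (hf.support h)

lemma IsTest.eLpNorm_restrict {F : Type*} [NormedAddCommGroup F] [NormedSpace ℝ F] {Ω : Set Vec}
    {f : Vec → F} (hf : IsTest Ω f) (hΩ : MeasurableSet Ω) (p : ℝ≥0∞) :
    eLpNorm f p (volume.restrict Ω) = eLpNorm f p volume := by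
  rw [← eLpNorm_indicator_eq_eLpNorm_restrict hΩ]
  congr 1
  exact Set.indicator_eq_self.2 fun x hx => by
    by_contra h
    exact hx (hf.eq_zero_of_notMem h)

/-! ### The Hilbert space `X` -/

section

variable {Ω : Set Vec}

lemma X.inner_def (V W : X Ω) :
    inner ℝ V W = inner ℝ V.grad W.grad + (1 / 2 : ℝ) * inner ℝ V.val W.val := rfl

lemma X.norm_sq (V : X Ω) : ‖V‖ ^ 2 = ‖V.grad‖ ^ 2 + (1 / 2) * ‖V.val‖ ^ 2 := by
  rw [← real_inner_self_eq_norm_sq, X.inner_def, real_inner_self_eq_norm_sq,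
    real_inner_self_eq_norm_sq]

lemma X.norm_grad_le (V : X Ω) : ‖V.grad‖ ≤ ‖V‖ := by
  have := V.norm_sq
  exact abs_le_of_sq_le_sq' (by nlinarith [sq_nonneg ‖V.val‖]) (norm_nonneg _) |>.2

lemma X.norm_val_le (V : X Ω) : ‖V.val‖ ≤ 2 * ‖V‖ := by
  have := V.norm_sq
  exact abs_le_of_sq_le_sq' (by nlinarith [sq_nonneg ‖V.grad‖, sq_nonneg ‖V‖])
    (by positivity) |>.2

lemma X.norm_le (V : X Ω) : ‖V‖ ≤ ‖V.grad‖ + ‖V.val‖ := by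
  have := V.norm_sq
  have h1 := norm_nonneg V.grad
  have h2 := norm_nonneg V.val
  exact abs_le_of_sq_le_sq' (by nlinarith [mul_nonneg h1 h2]) (by positivity) |>.2

/-- The embedding `X → L²`. -/
def X.valL (Ω : Set Vec) : X Ω →L[ℝ] Lp Vec 2 (volume.restrict Ω) :=
  LinearMap.mkContinuous ⟨⟨X.val, X.val_add⟩, X.val_smul⟩ 2 X.norm_val_le

/-- The gradient `X → L²`. -/
def X.gradL (Ω : Set Vec) : X Ω →L[ℝ] Lp Grad 2 (volume.restrict Ω) :=
  LinearMap.mkContinuous ⟨⟨X.grad, X.grad_add⟩, X.grad_smul⟩ 1 fun V => by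
    rw [one_mul]; exact X.norm_grad_le V

/-- The divergence constraint is the kernel of a continuous map on L², namely the pointwise trace.
-/
lemma isClosed_H10sigma : IsClosed (H10sigma Ω : Set (L2Pair Ω)) := by
  have h : (H10sigma Ω : Set (L2Pair Ω)) = (H10 Ω : Set (L2Pair Ω)) ∩
      {p | traceGradL.compLpL 2 (volume.restrict Ω) p.2 = 0} := by
    ext p
    refine and_congr Iff.rfl ?_
    rw [Set.mem_ofPred_eq, Lp.eq_zero_iff_ae_eq_zero]
    have := traceGradL.coeFn_compLpL (p := 2) (μ := volume.restrict Ω) p.2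
    constructor
    · intro h
      filter_upwards [h, this] with x h1 h2
      rw [h2, traceGradL_apply]; exact h1
    · intro h
      filter_upwards [h, this] with x h1 h2
      rw [h2, traceGradL_apply] at h1; exact h1
  rw [h]
  refine (Submodule.isClosed_topologicalClosure _).inter ?_
  exact isClosed_eq (by fun_prop) continuous_const

/-- The norm of X is equivalent to the product norm, so a limit can be taken in each component; it
stays in the closed subspace. Lax–Milgram and the final compactness argument rely on this. -/
instance : CompleteSpace (X Ω) := by
  refine Metric.complete_of_cauchySeq_tendsto fun u hu => ?_
  have h1 : CauchySeq fun n => (u n).val := hu.map (X.valL Ω).uniformContinuous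
  have h2 : CauchySeq fun n => (u n).grad := hu.map (X.gradL Ω).uniformContinuous
  obtain ⟨v, hv⟩ := cauchySeq_tendsto_of_complete h1
  obtain ⟨D, hD⟩ := cauchySeq_tendsto_of_complete h2
  have hmem : ((v, D) : L2Pair Ω) ∈ H10sigma Ω :=
    isClosed_H10sigma.mem_of_tendsto (hv.prodMk_nhds hD) (Eventually.of_forall fun n => (u n).2)
  let U : X Ω := ⟨(v, D), hmem⟩
  refine ⟨U, ?_⟩
  rw [tendsto_iff_norm_sub_tendsto_zero] at hv hD ⊢
  refine squeeze_zero (fun _ => norm_nonneg _) (fun n => X.norm_le _) ?_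
  have := hD.add hv
  rw [add_zero] at this
  exact this

/-- The element of `X` defined by a solenoidal test field. -/
def X.ofTest {ζ : Vec → Vec} (hζ : IsSolenoidalTest Ω ζ) : X Ω :=
  ⟨((hζ.test.memLp 2 (volume.restrict Ω)).toLp ζ,
    (hζ.test.classicalGrad.memLp 2 (volume.restrict Ω)).toLp (classicalGrad ζ)),
    Submodule.le_topologicalClosure _ ⟨ζ, hζ.test,
      MemLp.coeFn_toLp (hζ.test.memLp 2 (volume.restrict Ω)),
      MemLp.coeFn_toLp (hζ.test.classicalGrad.memLp 2 (volume.restrict Ω))⟩, by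
      filter_upwards [MemLp.coeFn_toLp (hζ.test.classicalGrad.memLp 2 (volume.restrict Ω))]
        with x hx
      rw [hx]; exact hζ.div_eq_zero x⟩

lemma X.ofTest_grad {ζ : Vec → Vec} (hζ : IsSolenoidalTest Ω ζ) :
    (X.ofTest hζ).grad =
      (hζ.test.classicalGrad.memLp 2 (volume.restrict Ω)).toLp (classicalGrad ζ) := rfl

end

/-! ### Mollification -/

/-- Minkowski's integral inequality in `L²` for a probability measure. -/
lemma eLpNorm_integral_le {α β F : Type*} [MeasurableSpace α] [MeasurableSpace β]
    [NormedAddCommGroup F] [NormedSpace ℝ F] {μ : Measure α} [SFinite μ] {ν : Measure β}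
    [IsProbabilityMeasure ν] {f : α → β → F} {M : ℝ≥0∞}
    (hf : AEStronglyMeasurable (Function.uncurry f) (μ.prod ν))
    (h : ∀ᵐ b ∂ν, eLpNorm (fun a => f a b) 2 μ ≤ M) :
    eLpNorm (fun a => ∫ b, f a b ∂ν) 2 μ ≤ M := by
  have key : ∀ {γ G : Type _} [MeasurableSpace γ] [NormedAddCommGroup G] (τ : Measure γ) (g : γ → G),
      eLpNorm g 2 τ ^ (2 : ℝ) = ∫⁻ x, ‖g x‖ₑ ^ (2 : ℝ) ∂τ := fun τ g => by
    simpa using eLpNorm_nnreal_pow_eq_lintegral (f := g) (μ := τ) (p := 2) (by norm_num)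
  have key' : ∀ (g : β → F),
      eLpNorm g 2 ν ^ (2 : ℝ) = ∫⁻ x, ‖g x‖ₑ ^ (2 : ℝ) ∂ν := fun g => by
    simpa using eLpNorm_nnreal_pow_eq_lintegral (f := g) (μ := ν) (p := 2) (by norm_num)
  rw [← ENNReal.rpow_le_rpow_iff (z := 2) (by norm_num), key]
  -- Since `ν` has mass one, the L¹ norm in `b` is at most the L² norm. Tonelli then exchanges the
  -- two integrals of the square.
  calc ∫⁻ a, ‖∫ b, f a b ∂ν‖ₑ ^ (2 : ℝ) ∂μ
      ≤ ∫⁻ a, ∫⁻ b, ‖f a b‖ₑ ^ (2 : ℝ) ∂ν ∂μ := by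
        refine lintegral_mono_ae ?_
        filter_upwards [hf.prodMk_left] with a ha
        rw [← key']
        refine ENNReal.rpow_le_rpow ?_ (by norm_num)
        refine (enorm_integral_le_lintegral_enorm _).trans ?_
        rw [← eLpNorm_one_eq_lintegral_enorm]
        exact eLpNorm_le_eLpNorm_of_exponent_le (by norm_num) ha
    _ = ∫⁻ b, ∫⁻ a, ‖f a b‖ₑ ^ (2 : ℝ) ∂μ ∂ν :=
        lintegral_lintegral_swap (hf.enorm.pow_const _)
    _ ≤ ∫⁻ _, M ^ (2 : ℝ) ∂ν := by
        refine lintegral_mono_ae ?_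
        filter_upwards [h] with b hb
        rw [← key]
        exact ENNReal.rpow_le_rpow hb (by norm_num)
    _ = M ^ (2 : ℝ) := by simp

section

variable {F : Type*} [NormedAddCommGroup F] [NormedSpace ℝ F]

omit [NormedSpace ℝ F] in
lemma eLpNorm_comp_sub_right {u : Vec → F} (hu : AEStronglyMeasurable u volume) (p : ℝ≥0∞)
    (h : Vec) : eLpNorm (fun x => u (x - h)) p volume = eLpNorm u p volume :=
  eLpNorm_comp_measurePreserving hu (measurePreserving_sub_right volume h)

/-- Translates of a smooth compactly supported function differ in `L²` by at most the length of the
translation times the norm of the derivative. -/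
lemma IsTest.eLpNorm_translate_sub_le [CompleteSpace F] {φ : Vec → F} (hφ : IsTest Set.univ φ)
    (h : Vec) :
    eLpNorm (fun x => φ (x - h) - φ x) 2 volume ≤
      ‖h‖ₑ * eLpNorm (_root_.fderiv ℝ φ) 2 volume := by
  have hD : Continuous (_root_.fderiv ℝ φ) := hφ.fderiv.smooth.continuous
  -- Fundamental theorem of calculus along the segment from `x` to `x - h`. Minkowski over `s ∈ (0,
  -- 1]` then reduces the claim to translates of the derivative.
  have h1 : ∀ x, φ (x - h) - φ x =
      ∫ s in Set.Ioc (0 : ℝ) 1, _root_.fderiv ℝ φ (x - s • h) (-h) := by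
    intro x
    rw [← intervalIntegral.integral_of_le zero_le_one]
    have hder : ∀ s ∈ Set.uIcc (0 : ℝ) 1,
        HasDerivAt (fun s : ℝ => φ (x - s • h)) (_root_.fderiv ℝ φ (x - s • h) (-h)) s := by
      intro s _
      have h2 : HasDerivAt (fun s : ℝ => x - s • h) (-h) s := by
        simpa using ((hasDerivAt_id s).smul_const h).const_sub x
      exact ((hφ.smooth.differentiable (by simp)).differentiableAt.hasFDerivAt).comp_hasDerivAt s h2
    rw [intervalIntegral.integral_eq_sub_of_hasDerivAt hder]
    · simp
    · exact Continuous.intervalIntegrable (by fun_prop) _ _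
  simp_rw [h1]
  have : IsProbabilityMeasure (volume.restrict (Set.Ioc (0 : ℝ) 1)) := ⟨by simp⟩
  refine eLpNorm_integral_le ?_ (Eventually.of_forall fun s => ?_)
  · refine Continuous.aestronglyMeasurable ?_
    unfold Function.uncurry
    fun_prop
  · rw [← eLpNorm_comp_sub_right hD.aestronglyMeasurable 2 (s • h), ← ofReal_norm]
    refine eLpNorm_le_mul_eLpNorm_of_ae_le_mul (Eventually.of_forall fun x => ?_) 2
    rw [mul_comm, ← norm_neg h]
    exact ContinuousLinearMap.le_opNorm _ _

/-- The probability measure with density a normalized bump function. -/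
def bumpMeasure (ρ : ContDiffBump (0 : Vec)) : Measure Vec :=
  volume.withDensity fun y => ENNReal.ofReal (ρ.normed volume y)

instance (ρ : ContDiffBump (0 : Vec)) : IsProbabilityMeasure (bumpMeasure ρ) := ⟨by
  rw [bumpMeasure, withDensity_apply _ MeasurableSet.univ, Measure.restrict_univ,
    ← ofReal_integral_eq_lintegral_ofReal ρ.integrable_normed
      (Eventually.of_forall ρ.nonneg_normed), ρ.integral_normed, ENNReal.ofReal_one]⟩

lemma bumpMeasure_absolutelyContinuous (ρ : ContDiffBump (0 : Vec)) : bumpMeasure ρ ≪ volume :=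
  withDensity_absolutelyContinuous _ _

/-- Mollification by a normalized bump function. -/
def moll (ρ : ContDiffBump (0 : Vec)) (u : Vec → F) : Vec → F :=
  ρ.normed volume ⋆[ContinuousLinearMap.lsmul ℝ ℝ, volume] u

lemma measurable_ofReal_normed (ρ : ContDiffBump (0 : Vec)) :
    Measurable fun y => ENNReal.ofReal (ρ.normed volume y) :=
  ρ.continuous_normed.measurable.ennreal_ofReal

/-- A mollification is an average of translates over a probability measure, the form to which
`eLpNorm_integral_le` applies. -/
lemma moll_eq_integral_bumpMeasure (ρ : ContDiffBump (0 : Vec)) (u : Vec → F) (x : Vec) :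
    moll ρ u x = ∫ y, u (x - y) ∂(bumpMeasure ρ) := by
  rw [bumpMeasure, integral_withDensity_eq_integral_toReal_smul (measurable_ofReal_normed ρ)
    (by simp), moll, convolution_def]
  simp [ENNReal.toReal_ofReal (ρ.nonneg_normed _)]

lemma moll_eq_integral_swap (ρ : ContDiffBump (0 : Vec)) (u : Vec → F) (x : Vec) :
    moll ρ u x = ∫ y, ρ.normed volume (x - y) • u y := by
  rw [moll, convolution_eq_swap]
  rfl

omit [NormedSpace ℝ F] in
lemma aestronglyMeasurable_sub_prod {u : Vec → F} (hu : AEStronglyMeasurable u volume)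
    (ν : Measure Vec) [SFinite ν] (hν : ν ≪ volume) :
    AEStronglyMeasurable (fun p : Vec × Vec => u (p.1 - p.2)) (volume.prod ν) :=
  (hu.comp_quasiMeasurePreserving (quasiMeasurePreserving_sub volume volume)).mono_ac
    (Measure.AbsolutelyContinuous.rfl.prod hν)

lemma eLpNorm_moll_le (ρ : ContDiffBump (0 : Vec)) {u : Vec → F}
    (hu : AEStronglyMeasurable u volume) :
    eLpNorm (moll ρ u) 2 volume ≤ eLpNorm u 2 volume := by
  simp_rw [funext (moll_eq_integral_bumpMeasure ρ u)]
  refine eLpNorm_integral_le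
    (aestronglyMeasurable_sub_prod hu _ (bumpMeasure_absolutelyContinuous ρ))
    (Eventually.of_forall fun y => (eLpNorm_comp_sub_right hu 2 y).le)

lemma ae_bumpMeasure_norm_le (ρ : ContDiffBump (0 : Vec)) : ∀ᵐ y ∂(bumpMeasure ρ),
    ‖y‖ ≤ ρ.rOut := by
  rw [bumpMeasure, ae_withDensity_iff (measurable_ofReal_normed ρ)]
  refine Eventually.of_forall fun y hy => ?_
  have h : y ∈ Function.support (ρ.normed volume) := fun h => hy (by simp [h])
  rw [ρ.support_normed_eq] at h
  simpa using (Metric.mem_ball.1 h).le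

/-- Average the translation estimate over shifts of length at most `ρ.rOut`. The rate is linear in
the radius and depends on `φ` only through its derivative in L², which is what Rellich's theorem
needs. -/
lemma IsTest.eLpNorm_moll_sub_le [CompleteSpace F] {φ : Vec → F} (hφ : IsTest Set.univ φ)
    (ρ : ContDiffBump (0 : Vec)) :
    eLpNorm (moll ρ φ - φ) 2 volume ≤
      ENNReal.ofReal ρ.rOut * eLpNorm (_root_.fderiv ℝ φ) 2 volume := by
  have hac := bumpMeasure_absolutelyContinuous ρ
  have h1 : moll ρ φ - φ = fun x => ∫ y, (φ (x - y) - φ x) ∂(bumpMeasure ρ) := by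
    ext x
    rw [integral_sub, Pi.sub_apply, moll_eq_integral_bumpMeasure]
    · simp
    · obtain ⟨C, hC⟩ := hφ.smooth.continuous.bounded_above_of_compact_support hφ.compact
      exact Integrable.of_bound (Continuous.aestronglyMeasurable
        (hφ.smooth.continuous.comp (by fun_prop))) C (Eventually.of_forall fun y => hC _)
    · exact integrable_const _
  rw [h1]
  refine eLpNorm_integral_le ?_ ?_
  · refine Continuous.aestronglyMeasurable ?_
    have := hφ.smooth.continuous
    unfold Function.uncurry
    fun_prop
  · filter_upwards [ae_bumpMeasure_norm_le ρ] with y hy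
    refine (hφ.eLpNorm_translate_sub_le y).trans ?_
    gcongr
    rw [← ofReal_norm]
    exact ENNReal.ofReal_le_ofReal hy

lemma moll_sub (ρ : ContDiffBump (0 : Vec)) {u v : Vec → F}
    (hu : LocallyIntegrable u volume) (hv : LocallyIntegrable v volume) :
    moll ρ (u - v) = moll ρ u - moll ρ v := by
  have hint : ∀ w : Vec → F, LocallyIntegrable w volume → ∀ x : Vec,
      Integrable (fun y => ρ.normed volume y • w (x - y)) volume := by
    intro w hw x
    exact ρ.hasCompactSupport_normed.convolutionExists_left
      (ContinuousLinearMap.lsmul ℝ ℝ) ρ.continuous_normed hw x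
  ext x
  simp only [moll, convolution_def, Pi.sub_apply, ContinuousLinearMap.lsmul_apply, smul_sub]
  exact integral_sub (hint u hu x) (hint v hv x)

lemma contDiff_moll [CompleteSpace F] (ρ : ContDiffBump (0 : Vec)) {u : Vec → F}
    (hu : LocallyIntegrable u volume) : ContDiff ℝ ∞ (moll ρ u) :=
  ρ.hasCompactSupport_normed.contDiff_convolution_left _ ρ.contDiff_normed hu

lemma support_moll_subset (ρ : ContDiffBump (0 : Vec)) (u : Vec → F) {K : Set Vec}
    (hu : Function.support u ⊆ K) :
    Function.support (moll ρ u) ⊆ Metric.cthickening ρ.rOut K := by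
  refine (support_convolution_subset (L := ContinuousLinearMap.lsmul ℝ ℝ)).trans ?_
  rintro _ ⟨a, ha, b, hb, rfl⟩
  rw [ρ.support_normed_eq] at ha
  refine Metric.mem_cthickening_of_dist_le _ b _ _ (hu hb) ?_
  simpa using (Metric.mem_ball.1 ha).le

/-- The derivative of a mollification of a function with an integrated-by-parts gradient. -/
lemma pderiv_moll [CompleteSpace F] (ρ : ContDiffBump (0 : Vec)) {u D : Vec → F} {j : Fin 3}
    (hu : LocallyIntegrable u volume)
    (hD : ∀ φ : Vec → ℝ, IsTest Set.univ φ → ∫ x, pderiv φ j x • u x = - ∫ x, φ x • D x)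
    (x : Vec) : pderiv (moll ρ u) j x = moll ρ D x := by
  have h1 := ρ.hasCompactSupport_normed.hasFDerivAt_convolution_left
    (ContinuousLinearMap.lsmul ℝ ℝ) (ρ.contDiff_normed (μ := volume) (n := 1)) hu x
  rw [pderiv, moll, h1.fderiv, convolution_eq_swap, ContinuousLinearMap.integral_apply]
  -- The reflected kernel serves as test function. Its derivative in `y` is minus that of the
  -- kernel, which absorbs the sign of the integration by parts.
  · have h2 := hD (fun y => ρ.normed volume (x - y)) ⟨
      ρ.contDiff_normed.comp (contDiff_const.sub contDiff_id),
      ρ.hasCompactSupport_normed.comp_homeomorph (Homeomorph.subLeft x), Set.subset_univ _⟩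
    rw [moll_eq_integral_swap, ← neg_eq_iff_eq_neg.2 h2, ← integral_neg]
    congr 1
    ext y
    have h3 : HasFDerivAt (fun y => ρ.normed volume (x - y))
        ((fderiv ℝ (ρ.normed volume) (x - y)).comp (-ContinuousLinearMap.id ℝ Vec)) y :=
      ((ρ.contDiff_normed (n := 1)).differentiable (by simp) _).hasFDerivAt.comp y
        ((hasFDerivAt_id y).const_sub x)
    rw [pderiv, h3.fderiv]
    simp [ContinuousLinearMap.precompL_apply]
  · have h4 : ConvolutionExistsAt (fderiv ℝ (ρ.normed volume)) u x
        ((ContinuousLinearMap.lsmul ℝ ℝ : ℝ →L[ℝ] F →L[ℝ] F).precompL Vec) volume :=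
      (ρ.hasCompactSupport_normed.fderiv (𝕜 := ℝ)).convolutionExists_left _
        ((ρ.contDiff_normed (n := 1)).continuous_fderiv one_ne_zero) hu x
    exact h4.integrable_swap

end

section

variable {Ω : Set Vec}

/-! ### Properties of `H10` inherited from test fields -/

/-- A closed condition satisfied by all pairs `(φ, ∇φ)` holds on `H10`. -/
lemma H10_induction {P : L2Pair Ω → Prop} (hclosed : IsClosed {p | P p})
    (htest : ∀ φ : Vec → Vec, ∀ hφ : IsTest Ω φ,
      P ((hφ.memLp 2 (volume.restrict Ω)).toLp φ,
        (hφ.classicalGrad.memLp 2 (volume.restrict Ω)).toLp (classicalGrad φ)))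
    {p : L2Pair Ω} (hp : p ∈ H10 Ω) : P p := by
  refine closure_minimal (s := (testPairs Ω : Set (L2Pair Ω))) (t := {p | P p}) ?_ hclosed hp
  rintro q ⟨φ, hφ, h1, h2⟩
  have hq : q = ((hφ.memLp 2 (volume.restrict Ω)).toLp φ,
      (hφ.classicalGrad.memLp 2 (volume.restrict Ω)).toLp (classicalGrad φ)) :=
    Prod.ext (Lp.ext (h1.trans (hφ.memLp 2 (volume.restrict Ω)).coeFn_toLp.symm))
      (Lp.ext (h2.trans (hφ.classicalGrad.memLp 2 (volume.restrict Ω)).coeFn_toLp.symm))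
  rw [hq]
  exact htest φ hφ

/-- Integration against a fixed square integrable function. -/
def pairWith {E F G : Type*} [NormedAddCommGroup E] [NormedSpace ℝ E] [NormedAddCommGroup F]
    [NormedSpace ℝ F] [NormedAddCommGroup G] [NormedSpace ℝ G] [CompleteSpace G]
    (B : E →L[ℝ] F →L[ℝ] G) {μ : Measure Vec} {φ : Vec → E} (hφ : MemLp φ 2 μ) :
    Lp F 2 μ →L[ℝ] G :=
  B.lpPairing μ 2 2 (hφ.toLp φ)

lemma pairWith_apply {E F G : Type*} [NormedAddCommGroup E] [NormedSpace ℝ E]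
    [NormedAddCommGroup F] [NormedSpace ℝ F] [NormedAddCommGroup G] [NormedSpace ℝ G]
    [CompleteSpace G] (B : E →L[ℝ] F →L[ℝ] G) {μ : Measure Vec} {φ : Vec → E}
    (hφ : MemLp φ 2 μ) (f : Lp F 2 μ) : pairWith B hφ f = ∫ x, B (φ x) (f x) ∂μ := by
  rw [pairWith, ContinuousLinearMap.lpPairing_eq_integral]
  refine integral_congr_ae ?_
  filter_upwards [hφ.coeFn_toLp] with x hx
  rw [hx]

lemma IsTest.pderiv {φ : Vec → ℝ} (hφ : IsTest Ω φ) (j : Fin 3) :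
    IsTest Ω (pderiv φ j) :=
  hφ.fderiv.clm_comp (ContinuousLinearMap.apply ℝ ℝ (EuclideanSpace.single j (1 : ℝ)))

/-- Here `φ` need not vanish near the boundary: the identity says that the extension by zero has the
extended gradient as weak gradient on all of space. It passes to the closure because it holds for
fields supported in `Ω`. -/
lemma H10_integral_by_parts {p : L2Pair Ω} (hp : p ∈ H10 Ω)
    {φ : Vec → ℝ} (hφ : IsTest Set.univ φ) (j : Fin 3) :
    ∫ x in Ω, pderiv φ j x • p.1 x = - ∫ x in Ω, φ x • p.2 x j := by
  set μ := volume.restrict Ω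
  let S : ℝ →L[ℝ] Vec →L[ℝ] Vec := ContinuousLinearMap.lsmul ℝ ℝ
  let S' : ℝ →L[ℝ] Grad →L[ℝ] Vec := (S.flip ∘L PiLp.proj 2 (fun _ : Fin 3 => Vec) j).flip
  have h1 : ∀ q : L2Pair Ω, pairWith S ((hφ.pderiv j).memLp 2 μ) q.1 =
      ∫ x in Ω, pderiv φ j x • q.1 x := fun q => pairWith_apply _ _ _
  have h2 : ∀ q : L2Pair Ω, pairWith S' (hφ.memLp 2 μ) q.2 =
      ∫ x in Ω, φ x • q.2 x j := fun q => pairWith_apply _ _ _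
  rw [← h1, ← h2]
  refine H10_induction (P := fun q => pairWith S ((hφ.pderiv j).memLp 2 μ) q.1 =
    -pairWith S' (hφ.memLp 2 μ) q.2) ?_ ?_ hp
  · exact isClosed_eq (by fun_prop) (by fun_prop)
  · intro ψ hψ
    rw [h1, h2]
    have h3 : ∫ x in Ω, pderiv φ j x • (hψ.memLp 2 μ).toLp ψ x = ∫ x, pderiv φ j x • ψ x := by
      refine Eq.trans (integral_congr_ae ?_)
        (setIntegral_eq_integral_of_forall_compl_eq_zero (s := Ω)
          fun x hx => by rw [hψ.eq_zero_of_notMem hx, smul_zero])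
      filter_upwards [(hψ.memLp 2 μ).coeFn_toLp] with x hx
      rw [hx]
    have h4 : ∫ x in Ω, φ x • (hψ.classicalGrad.memLp 2 μ).toLp (classicalGrad ψ) x j =
        ∫ x, φ x • fderiv ℝ ψ x (EuclideanSpace.single j 1) := by
      refine Eq.trans (integral_congr_ae ?_)
        (setIntegral_eq_integral_of_forall_compl_eq_zero (s := Ω)
          fun x hx => by rw [hψ.fderiv.eq_zero_of_notMem hx]; simp)
      filter_upwards [(hψ.classicalGrad.memLp 2 μ).coeFn_toLp] with x hx
      rw [hx]
      rfl
    rw [h3, h4, integral_smul_fderiv_eq_neg_fderiv_smul_of_integrable, neg_neg]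
    · rfl
    · exact ((((hφ.pderiv j).smooth.continuous.smul hψ.smooth.continuous)
        ).integrable_of_hasCompactSupport (hψ.compact.smul_left))
    · refine Continuous.integrable_of_hasCompactSupport ?_ hφ.compact.smul_right
      exact hφ.smooth.continuous.smul (hψ.fderiv.smooth.continuous.clm_apply continuous_const)
    · exact (hφ.smooth.continuous.smul hψ.smooth.continuous).integrable_of_hasCompactSupport
        (hψ.compact.smul_left)
    · exact fun x _ => (hφ.smooth.differentiable (by simp)).differentiableAt
    · exact fun x _ => (hψ.smooth.differentiable (by simp)).differentiableAt

lemma eLpNorm_fderiv_le_classicalGrad (f : Vec → Vec) (p : ℝ≥0∞) (μ : Measure Vec) :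
    eLpNorm (fderiv ℝ f) p μ ≤ eLpNorm (classicalGrad f) p μ :=
  eLpNorm_mono fun x => norm_fderiv_le_classicalGrad f x

/-- The Sobolev inequality on `H10`. -/
lemma exists_sobolev_H10 (hΩ : MeasurableSet Ω) : ∃ C : ℝ≥0, ∀ p ∈ H10 Ω,
    eLpNorm p.1 6 (volume.restrict Ω) ≤ C * ‖p.2‖ₑ := by
  refine ⟨SNormLESNormFDerivOfEqConst Vec (volume : Measure Vec) 2, fun p hp => ?_⟩
  refine H10_induction (P := fun p => eLpNorm p.1 6 (volume.restrict Ω) ≤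
    SNormLESNormFDerivOfEqConst Vec (volume : Measure Vec) 2 * ‖p.2‖ₑ) ?_ ?_ hp
  -- The L⁶ norm is only lower semicontinuous under L² convergence. Fatou along an almost everywhere
  -- convergent subsequence is enough for a closed condition.
  · refine IsSeqClosed.isClosed fun q p hq hqp => ?_
    have h1 : Tendsto (fun n => (q n).1) atTop (𝓝 p.1) := (continuous_fst.tendsto p).comp hqp
    have h2 : Tendsto (fun n => (q n).2) atTop (𝓝 p.2) := (continuous_snd.tendsto p).comp hqp
    obtain ⟨ns, hns, hae⟩ := (tendstoInMeasure_of_tendsto_Lp h1).exists_seq_tendsto_ae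
    refine (Lp.eLpNorm_lim_le_liminf_eLpNorm
      (fun n => Lp.aestronglyMeasurable ((q (ns n)).1)) _ hae).trans ?_
    have h3 : Tendsto (fun n => (SNormLESNormFDerivOfEqConst Vec (volume : Measure Vec) 2 : ℝ≥0∞)
        * ‖(q (ns n)).2‖ₑ) atTop
        (𝓝 (SNormLESNormFDerivOfEqConst Vec (volume : Measure Vec) 2 * ‖p.2‖ₑ)) :=
      ENNReal.Tendsto.const_mul
        ((continuous_enorm.tendsto _).comp (h2.comp hns.tendsto_atTop)) (Or.inr (by simp))
    rw [← h3.liminf_eq]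
    exact liminf_le_liminf (Eventually.of_forall fun n => hq (ns n))
  · intro φ hφ
    rw [eLpNorm_congr_ae (MemLp.coeFn_toLp _), Lp.enorm_def, eLpNorm_congr_ae (MemLp.coeFn_toLp _),
      hφ.eLpNorm_restrict hΩ, hφ.classicalGrad.eLpNorm_restrict hΩ]
    have h := eLpNorm_le_eLpNorm_fderiv_of_eq (F := Vec) (μ := (volume : Measure Vec)) (u := φ)
      (p := 2) (p' := 6) (hφ.smooth.of_le (by simp)) hφ.compact (by norm_num) (by simp)
      (by simp; norm_num)
    refine (le_trans (by exact_mod_cast h) ?_)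
    gcongr
    exact eLpNorm_fderiv_le_classicalGrad _ _ _

/-- Poincaré's inequality on `H10`. -/
lemma exists_poincare_H10 (hΩ : MeasurableSet Ω) (hb : Bornology.IsBounded Ω) :
    ∃ C : ℝ≥0, ∀ p ∈ H10 Ω, ‖p.1‖ ≤ C * ‖p.2‖ := by
  refine ⟨eLpNormLESNormFDerivOfLeConst Vec (volume : Measure Vec) Ω 2 2, fun p hp => ?_⟩
  refine H10_induction (P := fun p => ‖p.1‖ ≤
    eLpNormLESNormFDerivOfLeConst Vec (volume : Measure Vec) Ω 2 2 * ‖p.2‖) ?_ ?_ hp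
  · exact isClosed_le (by fun_prop) (by fun_prop)
  · intro φ hφ
    have h := eLpNorm_le_eLpNorm_fderiv (F := Vec) (μ := (volume : Measure Vec)) (u := φ)
      (s := Ω) (p := 2) (hφ.smooth.of_le (by simp)) (subset_closure.trans hφ.support)
      (by norm_num) (by simp; norm_num) hb
    have h2 := h.trans (mul_le_mul_right (eLpNorm_fderiv_le_classicalGrad φ _ _) _)
    rw [← hφ.eLpNorm_restrict hΩ, ← hφ.classicalGrad.eLpNorm_restrict hΩ] at h2
    have h3 := ENNReal.toReal_mono
      (ENNReal.mul_ne_top (by simp) (hφ.classicalGrad.memLp _ _).eLpNorm_ne_top) h2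
    rw [ENNReal.toReal_mul] at h3
    simpa [Lp.norm_toLp] using h3

/-! ### Rellich's theorem -/

/-- Quantitative form of Rellich's theorem: up to a finite number of linear functionals, the `L²`
norm is small compared with the `H¹` norm. -/
lemma exists_rellich (hΩ : MeasurableSet Ω) (hb : Bornology.IsBounded Ω) {ε : ℝ} (hε : 0 < ε) :
    ∃ (ι : Type) (_ : Fintype ι) (g : Lp Vec 2 (volume.restrict Ω) →L[ℝ] (ι → Vec)),
      ∀ p ∈ H10 Ω, ‖p.1‖ ≤ ε * (‖p.1‖ + ‖p.2‖) + ‖g p.1‖ := by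
  set μ := volume.restrict Ω with hμ
  have : IsFiniteMeasure μ := ⟨by rw [hμ, Measure.restrict_apply_univ]; exact hb.measure_lt_top⟩
  let v : ℝ := (measureUnivNNReal μ : ℝ) ^ (2 : ℝ≥0∞).toReal⁻¹
  have hv : 0 ≤ v := by positivity
  let S : ℝ →L[ℝ] Vec →L[ℝ] Vec := ContinuousLinearMap.lsmul ℝ ℝ
  let Λ := S.lpPairing μ 2 2
  -- Mollifying at scale `ε` costs at most `ε` times the gradient norm. The mollified field has a
  -- modulus of continuity controlled by its L² norm, so its values at a finite net determine it up
  -- to a small error.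
  let ρ : ContDiffBump (0 : Vec) := ⟨ε / 2, ε, by positivity, by linarith⟩
  let k : Vec → ℝ := ρ.normed volume
  have hk : ContDiff ℝ ∞ k := ρ.contDiff_normed
  have hkx : ∀ x, IsTest Set.univ (fun y => k (x - y)) := fun x =>
    ⟨hk.comp (contDiff_const.sub contDiff_id),
      ρ.hasCompactSupport_normed.comp_homeomorph (Homeomorph.subLeft x), Set.subset_univ _⟩
  let T : Vec → Lp Vec 2 μ →L[ℝ] Vec := fun x => pairWith S ((hkx x).memLp 2 μ)
  -- `η` is the allowed oscillation of the kernel. One factor `v = |Ω|^{1/2}` turns it into an L²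
  -- norm of the kernel difference, the other passes from a supremum over `Ω` to the L² norm of the
  -- mollification.
  obtain ⟨η, hη, hηε⟩ : ∃ η : ℝ, 0 < η ∧ v * (‖Λ‖ * (v * η)) ≤ ε := by
    refine ⟨ε / (v * ‖Λ‖ * v + 1), by positivity, ?_⟩
    have : 0 ≤ v * ‖Λ‖ * v := by positivity
    calc v * (‖Λ‖ * (v * (ε / (v * ‖Λ‖ * v + 1))))
        = (v * ‖Λ‖ * v) / (v * ‖Λ‖ * v + 1) * ε := by ring
      _ ≤ 1 * ε := by
        gcongr
        rw [div_le_one (by positivity)]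
        linarith
      _ = ε := one_mul _
  have huc : UniformContinuous k :=
    ρ.hasCompactSupport_normed.uniformContinuous_of_continuous hk.continuous
  obtain ⟨δ, hδ, hkδ⟩ := Metric.uniformContinuous_iff.1 huc η hη
  have hT : ∀ x z, dist x z < δ → ∀ f, ‖T x f - T z f‖ ≤ ‖Λ‖ * (v * η) * ‖f‖ := by
    intro x z hxz f
    have h1 : T x f - T z f =
        Λ (((hkx x).memLp 2 μ).toLp _ - ((hkx z).memLp 2 μ).toLp _) f := by
      rw [map_sub]; rfl
    rw [h1]
    refine (Λ.le_opNorm₂ _ _).trans ?_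
    gcongr
    rw [← MemLp.toLp_sub]
    refine Lp.norm_le_of_ae_bound hη.le ?_
    filter_upwards [MemLp.coeFn_toLp (((hkx x).memLp 2 μ).sub ((hkx z).memLp 2 μ))] with y hy
    rw [hy]
    refine le_of_lt ?_
    rw [Pi.sub_apply, ← dist_eq_norm]
    exact hkδ (by simpa using hxz)
  obtain ⟨t, -, htfin, htcov⟩ :=
    finite_cover_balls_of_compact hb.isCompact_closure hδ
  have : Fintype t := htfin.fintype
  refine ⟨t, inferInstance, v • ContinuousLinearMap.pi fun i : t => T i, fun p hp => ?_⟩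
  refine H10_induction (P := fun p => ‖p.1‖ ≤ ε * (‖p.1‖ + ‖p.2‖) +
    ‖(v • ContinuousLinearMap.pi fun i : t => T i) p.1‖) ?_ ?_ hp
  · exact isClosed_le (by fun_prop) (by fun_prop)
  intro φ hφ
  set f := (hφ.memLp 2 μ).toLp φ with hf
  set G := (ContinuousLinearMap.pi fun i : t => T i) f with hG
  have hmoll : ∀ x, moll ρ φ x = T x f := by
    intro x
    have : T x f = ∫ y in Ω, k (x - y) • f y := pairWith_apply _ _ _
    rw [this, moll_eq_integral_swap, ← setIntegral_eq_integral_of_forall_compl_eq_zero (s := Ω)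
      fun y hy => by rw [hφ.eq_zero_of_notMem hy, smul_zero]]
    refine integral_congr_ae ?_
    filter_upwards [(hφ.memLp 2 μ).coeFn_toLp] with y hy
    rw [hf, hy]
  have hsup : ∀ x ∈ Ω, ‖moll ρ φ x‖ ≤ ‖Λ‖ * (v * η) * ‖f‖ + ‖G‖ := by
    intro x hx
    obtain ⟨i, hi, hxi⟩ := Set.mem_iUnion₂.1 (htcov (subset_closure hx))
    have h2 : ‖T i f‖ ≤ ‖G‖ := norm_le_pi_norm G ⟨i, hi⟩
    calc ‖moll ρ φ x‖ = ‖(T x f - T i f) + T i f‖ := by rw [hmoll, sub_add_cancel]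
      _ ≤ _ := (norm_add_le _ _).trans (add_le_add (hT _ _ hxi f) h2)
  have hmc : Continuous (moll ρ φ) :=
    (contDiff_moll ρ hφ.smooth.continuous.locallyIntegrable).continuous
  have hmem : MemLp (moll ρ φ) 2 μ := by
    refine MemLp.of_bound hmc.aestronglyMeasurable (‖Λ‖ * (v * η) * ‖f‖ + ‖G‖) ?_
    exact (ae_restrict_iff' hΩ).2 (Eventually.of_forall hsup)
  have h1 : ‖hmem.toLp _‖ ≤ v * (‖Λ‖ * (v * η) * ‖f‖ + ‖G‖) := by
    refine Lp.norm_le_of_ae_bound (by positivity) ?_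
    filter_upwards [hmem.coeFn_toLp, (ae_restrict_iff' hΩ).2 (Eventually.of_forall hsup)]
      with x hx hx2
    rwa [hx]
  have h2 : ‖hmem.toLp _ - f‖ ≤
      ε * ‖(hφ.classicalGrad.memLp 2 μ).toLp (classicalGrad φ)‖ := by
    rw [hf, ← MemLp.toLp_sub, Lp.norm_toLp, Lp.norm_toLp]
    have h3 : eLpNorm (moll ρ φ - φ) 2 μ ≤
        ENNReal.ofReal ε * eLpNorm (classicalGrad φ) 2 μ := by
      refine (eLpNorm_mono_measure _ Measure.restrict_le_self).trans ?_
      refine ((hφ.mono (Set.subset_univ _)).eLpNorm_moll_sub_le ρ).trans ?_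
      rw [hφ.classicalGrad.eLpNorm_restrict hΩ]
      gcongr
      exact eLpNorm_fderiv_le_classicalGrad _ _ _
    have h4 := ENNReal.toReal_mono
      (ENNReal.mul_ne_top (by simp) (hφ.classicalGrad.memLp _ _).eLpNorm_ne_top) h3
    rwa [ENNReal.toReal_mul, ENNReal.toReal_ofReal hε.le] at h4
  have h5 : ‖f‖ ≤ ‖hmem.toLp _ - f‖ + ‖hmem.toLp _‖ := by
    rw [norm_sub_rev]
    simpa using norm_add_le (f - hmem.toLp _) (hmem.toLp _)
  have h6 : ‖(v • ContinuousLinearMap.pi fun i : t => T i) f‖ = v * ‖G‖ := by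
    rw [_root_.smul_apply, norm_smul, Real.norm_of_nonneg hv]
  change ‖f‖ ≤ ε * (‖f‖ + _) + ‖(v • ContinuousLinearMap.pi fun i : t => T i) f‖
  rw [h6]
  have h7 := mul_le_mul_of_nonneg_right hηε (norm_nonneg f)
  linarith

end

/-! ### The `H¹` norm of test fields -/

/-- The `H¹` norm (up to equivalence) of a smooth field on the whole space. -/
def hNorm (w : Vec → Vec) : ℝ≥0∞ := eLpNorm w 2 volume + eLpNorm (fderiv ℝ w) 2 volume

lemma hNorm_add_le {v w : Vec → Vec} (hv : ContDiff ℝ ∞ v) (hw : ContDiff ℝ ∞ w) :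
    hNorm (v + w) ≤ hNorm v + hNorm w := by
  have h1 : fderiv ℝ (v + w) = fderiv ℝ v + fderiv ℝ w := by
    ext1 x
    rw [fderiv_add (hv.differentiable (by simp) x) (hw.differentiable (by simp) x)]
    rfl
  unfold hNorm
  rw [h1]
  have h2 := eLpNorm_add_le (p := 2) (μ := volume) hv.continuous.aestronglyMeasurable
    hw.continuous.aestronglyMeasurable (by norm_num)
  have h3 := eLpNorm_add_le (p := 2) (μ := volume)
    (hv.continuous_fderiv (by simp)).aestronglyMeasurable
    (hw.continuous_fderiv (by simp)).aestronglyMeasurable (by norm_num)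
  calc _ ≤ _ := add_le_add h2 h3
    _ = _ := by ring

lemma eLpNorm_le_of_support_subset {F : Type*} [NormedAddCommGroup F] {f : Vec → F} {K : Set Vec}
    (hK : MeasurableSet K) (hf : Function.support f ⊆ K) {C : ℝ} (hC : ∀ x, ‖f x‖ ≤ C) :
    eLpNorm f 2 volume ≤ volume K ^ (2 : ℝ)⁻¹ * ENNReal.ofReal C := by
  have h : f = K.indicator f := (Set.indicator_eq_self.2 hf).symm
  rw [h, eLpNorm_indicator_eq_eLpNorm_restrict hK]
  refine (eLpNorm_le_of_ae_bound (Eventually.of_forall hC)).trans ?_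
  simp

/-- Lebesgue measure is a multiple of the three-dimensional Hausdorff measure, for which
antilipschitz maps satisfy this bound directly. It replaces a change of variables with Jacobians. -/
lemma exists_volume_preimage_le {K : ℝ≥0} : ∀ {ψ : Vec → Vec}, AntilipschitzWith K ψ →
    ∀ s : Set Vec, volume (ψ ⁻¹' s) ≤ (K : ℝ≥0∞) ^ (3 : ℝ) * volume s := by
  intro ψ hψ s
  have : (Measure.hausdorffMeasure (3 : ℝ) : Measure Vec).IsAddHaarMeasure := by
    have := isAddHaarMeasure_hausdorffMeasure (E := Vec)
    simpa using this
  rw [Measure.isAddLeftInvariant_eq_smul (volume : Measure Vec)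
    (Measure.hausdorffMeasure (3 : ℝ)), Measure.smul_apply, Measure.smul_apply, ENNReal.smul_def,
    ENNReal.smul_def, smul_eq_mul, smul_eq_mul, mul_left_comm]
  gcongr
  exact hψ.hausdorffMeasure_preimage_le (by norm_num) s

/-- Composition with a continuous antilipschitz map is bounded in `L²`. -/
lemma eLpNorm_comp_antilipschitz_le {F : Type*} [NormedAddCommGroup F] {K : ℝ≥0} {ψ : Vec → Vec}
    (hψ : AntilipschitzWith K ψ) (hψc : Continuous ψ) {g : Vec → F} (hg : Continuous g) :
    eLpNorm (fun x => g (ψ x)) 2 volume ≤ ((K ^ (3 : ℝ)) ^ (2 : ℝ)⁻¹ : ℝ≥0) * eLpNorm g 2 volume := by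
  have h1 : Measure.map ψ volume ≤ (K : ℝ≥0∞) ^ (3 : ℝ) • (volume : Measure Vec) :=
    Measure.le_iff.2 fun s hs => by
      rw [Measure.map_apply hψc.measurable hs]
      exact exists_volume_preimage_le hψ s
  have h2 : eLpNorm (fun x => g (ψ x)) 2 volume = eLpNorm g 2 (Measure.map ψ volume) := by
    have : SecondCountableTopologyEither Vec F := inferInstance
    exact (eLpNorm_map_measure hg.aestronglyMeasurable hψc.aemeasurable).symm
  rw [h2]
  refine (eLpNorm_mono_measure g h1).trans ?_
  rw [eLpNorm_smul_measure_of_ne_top (by norm_num), smul_eq_mul]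
  simp [ENNReal.coe_rpow_of_nonneg]

/-! ### Shears -/

/-- The data of a shear `x ↦ x - t φ(x) e`. -/
structure Shear where
  /-- The amplitude. -/
  φ : Vec → ℝ
  /-- The direction. -/
  e : Vec
  smooth : ContDiff ℝ ∞ φ
  compact : HasCompactSupport φ

namespace Shear

variable (s : Shear) (t : ℝ)

lemma isTest : IsTest Set.univ s.φ := ⟨s.smooth, s.compact, Set.subset_univ _⟩

/-- The shear map. -/
def map (x : Vec) : Vec := x - (t * s.φ x) • s.e

/-- `f ↦ e ⊗ f - f(e) id`, the linear part of the adjugate of `id - e ⊗ f`. -/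
def adj : (Vec →L[ℝ] ℝ) →L[ℝ] (Vec →L[ℝ] Vec) :=
  (ContinuousLinearMap.smulRightL ℝ Vec Vec).flip s.e -
    (ContinuousLinearMap.toSpanSingleton ℝ (ContinuousLinearMap.id ℝ Vec)) ∘L
      (ContinuousLinearMap.apply ℝ ℝ s.e)

lemma adj_apply (f : Vec →L[ℝ] ℝ) (v : Vec) : s.adj f v = f v • s.e - f s.e • v := by
  simp [adj]

/-- The Piola transform of a field under a shear. -/
def pull (w : Vec → Vec) (x : Vec) : Vec :=
  w (s.map t x) + t • s.adj (fderiv ℝ s.φ x) (w (s.map t x))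

lemma contDiff_map : ContDiff ℝ ∞ (s.map t) :=
  contDiff_id.sub ((contDiff_const.mul s.smooth).smul contDiff_const)

lemma contDiff_pull {w : Vec → Vec} (hw : ContDiff ℝ ∞ w) : ContDiff ℝ ∞ (s.pull t w) := by
  have h1 : ContDiff ℝ ∞ fun x => s.adj (fderiv ℝ s.φ x) :=
    s.adj.contDiff.comp s.isTest.fderiv.smooth
  have h2 := hw.comp (s.contDiff_map t)
  exact h2.add ((h1.clm_apply h2).const_smul t)

lemma pull_sub (v w : Vec → Vec) : s.pull t (v - w) = s.pull t v - s.pull t w := by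
  ext1 x
  simp only [pull, Pi.sub_apply, map_sub, smul_sub]
  abel

lemma pull_eq_zero {w : Vec → Vec} {x : Vec} (h : w (s.map t x) = 0) : s.pull t w x = 0 := by
  simp [pull, h]

/-- The derivative of the shear map. -/
def mapDeriv (x : Vec) : Vec →L[ℝ] Vec :=
  ContinuousLinearMap.id ℝ Vec - t • (fderiv ℝ s.φ x).smulRight s.e

lemma hasFDerivAt_map (x : Vec) : HasFDerivAt (s.map t) (s.mapDeriv t x) x := by
  have h1 : HasFDerivAt s.φ (fderiv ℝ s.φ x) x :=
    (s.smooth.differentiable (by simp) x).hasFDerivAt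
  have h2 := (hasFDerivAt_id x).sub ((h1.const_mul t).smul_const s.e)
  have h3 : s.mapDeriv t x = ContinuousLinearMap.id ℝ Vec - (t • fderiv ℝ s.φ x).smulRight s.e := by
    ext1 v
    simp [mapDeriv, smul_smul]
  rw [h3]
  exact h2

lemma fderiv_pull {w : Vec → Vec} (hw : ContDiff ℝ ∞ w) (x : Vec) :
    fderiv ℝ (s.pull t w) x = fderiv ℝ w (s.map t x) ∘L s.mapDeriv t x +
      t • (s.adj (fderiv ℝ s.φ x) ∘L (fderiv ℝ w (s.map t x) ∘L s.mapDeriv t x) +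
        (s.adj ∘L fderiv ℝ (fderiv ℝ s.φ) x).flip (w (s.map t x))) := by
  have h1 : HasFDerivAt (fun x => w (s.map t x)) (fderiv ℝ w (s.map t x) ∘L s.mapDeriv t x) x :=
    (hw.differentiable (by simp) _).hasFDerivAt.comp x (s.hasFDerivAt_map t x)
  have h2 : HasFDerivAt (fun x => s.adj (fderiv ℝ s.φ x))
      (s.adj ∘L fderiv ℝ (fderiv ℝ s.φ) x) x :=
    s.adj.hasFDerivAt.comp x (s.isTest.fderiv.smooth.differentiable (by simp) x).hasFDerivAt
  exact (h1.add ((h2.clm_apply h1).const_smul t)).fderiv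

lemma clm_apply_eq_sum {F : Type*} [NormedAddCommGroup F] [NormedSpace ℝ F] (f : Vec →L[ℝ] F)
    (v : Vec) : f v = ∑ j, v j • f (EuclideanSpace.single j 1) := by
  conv_lhs => rw [← sum_smul_single v]
  simp

/-- The Piola transform preserves solenoidal fields. -/
lemma div_pull {w : Vec → Vec} (hw : ContDiff ℝ ∞ w)
    (hdiv : ∀ x, traceGrad (classicalGrad w x) = 0) (x : Vec) :
    traceGrad (classicalGrad (s.pull t w) x) = 0 := by
  rw [classicalGrad_eq, s.fderiv_pull t hw]
  have h0 := hdiv (s.map t x)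
  rw [classicalGrad_eq] at h0
  -- The second derivatives of `φ` enter the divergence as H(e, v) - H(v, e), which vanishes by
  -- symmetry.
  have hsym : IsSymmSndFDerivAt ℝ s.φ x :=
    (contDiff_infty.1 s.smooth 2).contDiffAt.isSymmSndFDerivAt (by simp)
  set L := fderiv ℝ w (s.map t x)
  set f := fderiv ℝ s.φ x
  set H := fderiv ℝ (fderiv ℝ s.φ) x
  set v := w (s.map t x)
  have hfv : ∀ u, f u = ∑ j, u j • f (EuclideanSpace.single j 1) := clm_apply_eq_sum f
  have hLe : ∀ i, L s.e i = ∑ j, s.e j * L (EuclideanSpace.single j 1) i := fun i => by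
    rw [clm_apply_eq_sum L s.e]; simp
  have hHe : ∀ j, H (EuclideanSpace.single j 1) s.e = ∑ i, s.e i * H (EuclideanSpace.single i 1)
      (EuclideanSpace.single j 1) := fun j => by
    rw [clm_apply_eq_sum (H _) s.e]
    exact Finset.sum_congr rfl fun i _ => by rw [hsym (EuclideanSpace.single j 1)]; rfl
  have hHv : ∀ j, H (EuclideanSpace.single j 1) v = ∑ i, v i * H (EuclideanSpace.single j 1)
      (EuclideanSpace.single i 1) := fun j => by
    rw [clm_apply_eq_sum (H _) v]; rfl
  simp only [traceGrad, gradOfFDeriv_apply, mapDeriv, Fin.sum_univ_three] at h0 ⊢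
  simp only [_root_.add_apply, ContinuousLinearMap.comp_apply, _root_.sub_apply,
    _root_.smul_apply, ContinuousLinearMap.smulRight_apply, adj_apply,
    ContinuousLinearMap.flip_apply, map_sub, map_smul, ContinuousLinearMap.id_apply,
    PiLp.add_apply, PiLp.sub_apply, PiLp.smul_apply, smul_eq_mul]
  rw [hfv (L (EuclideanSpace.single 0 1)), hfv (L (EuclideanSpace.single 1 1)),
    hfv (L (EuclideanSpace.single 2 1)), hfv (L s.e), hfv s.e]
  simp only [hLe, hHe, hHv, Fin.sum_univ_three, smul_eq_mul]
  -- The coefficient is the Jacobian determinant 1 - t f(e) of the shear: the divergence of the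
  -- Piola transform is that determinant times (div w) ∘ ψ, with ψ the shear map.
  linear_combination (1 - t * (s.e 0 * f (EuclideanSpace.single 0 1) +
    s.e 1 * f (EuclideanSpace.single 1 1) + s.e 2 * f (EuclideanSpace.single 2 1))) * h0

/-- For small parameters a shear is antilipschitz. -/
lemma antilipschitz_map : ∀ᶠ t in 𝓝[>] (0 : ℝ), AntilipschitzWith 2 (s.map t) := by
  obtain ⟨K, hK⟩ := ContDiff.lipschitzWith_of_hasCompactSupport s.compact s.smooth (by simp)
  -- For such `t` the displacement is ½-Lipschitz, so distances shrink at most by the factor ½;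
  -- hence the constant 2.
  have h1 : ∀ᶠ t in 𝓝[>] (0 : ℝ), t * (K * ‖s.e‖) < 1 / 2 := by
    have : Tendsto (fun t : ℝ => t * (K * ‖s.e‖)) (𝓝[>] 0) (𝓝 (0 * (K * ‖s.e‖))) :=
      (tendsto_nhdsWithin_of_tendsto_nhds tendsto_id).mul_const _
    exact this.eventually (gt_mem_nhds (by norm_num))
  filter_upwards [h1, self_mem_nhdsWithin] with t ht ht0
  refine AntilipschitzWith.of_le_mul_dist fun x y => ?_
  have ht0' : 0 < t := ht0
  have h2 : ‖(t * s.φ x) • s.e - (t * s.φ y) • s.e‖ ≤ 1 / 2 * dist x y := by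
    rw [← sub_smul, ← mul_sub, norm_smul, norm_mul, Real.norm_of_nonneg ht0'.le,
      ← dist_eq_norm (s.φ x)]
    calc t * dist (s.φ x) (s.φ y) * ‖s.e‖ ≤ t * (K * dist x y) * ‖s.e‖ := by
          gcongr; exact hK.dist_le_mul x y
      _ = t * (K * ‖s.e‖) * dist x y := by ring
      _ ≤ _ := by gcongr
  have h3 : dist x y ≤ dist (s.map t x) (s.map t y) +
      ‖(t * s.φ x) • s.e - (t * s.φ y) • s.e‖ := by
    rw [dist_eq_norm, dist_eq_norm]
    have : x - y = (s.map t x - s.map t y) + ((t * s.φ x) • s.e - (t * s.φ y) • s.e) := by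
      simp only [map]; abel
    rw [this]
    exact norm_add_le _ _
  rw [NNReal.coe_ofNat]
  linarith

lemma exists_bound {F : Type*} [NormedAddCommGroup F] [NormedSpace ℝ F] {f : Vec → F}
    (hf : IsTest Set.univ f) : ∃ C : ℝ, 0 ≤ C ∧ ∀ x, ‖f x‖ ≤ C := by
  obtain ⟨C, hC⟩ := hf.smooth.continuous.bounded_above_of_compact_support hf.compact
  exact ⟨C, (norm_nonneg _).trans (hC 0), hC⟩

/-- Uniform boundedness of the Piola transforms in `H¹`. -/
lemma hNorm_pull_le : ∃ C : ℝ≥0, ∀ᶠ t in 𝓝[>] (0 : ℝ), ∀ w : Vec → Vec, ContDiff ℝ ∞ w →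
    hNorm (s.pull t w) ≤ C * hNorm w := by
  obtain ⟨m, hm0, hm⟩ := exists_bound (s.isTest.fderiv.clm_comp s.adj)
  obtain ⟨m', hm0', hm'⟩ := exists_bound s.isTest.fderiv.fderiv
  obtain ⟨m'', hm0'', hm''⟩ := exists_bound s.isTest.fderiv
  -- `c` is the cost in L² of composing with a map of antilipschitz constant 2. `a` bounds the
  -- transform pointwise; `b` and `d` are the coefficients of `fderiv ℝ w` and `w` in its
  -- derivative, with `t ≤ 1` absorbed.
  let c : ℝ≥0 := (2 ^ (3 : ℝ)) ^ (2 : ℝ)⁻¹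
  let a : ℝ := 1 + m
  let b : ℝ := (1 + m) * (1 + m'' * ‖s.e‖)
  let d : ℝ := ‖s.adj‖ * m'
  refine ⟨(a.toNNReal + b.toNNReal + d.toNNReal) * c, ?_⟩
  filter_upwards [s.antilipschitz_map, self_mem_nhdsWithin,
    nhdsWithin_le_nhds (Iic_mem_nhds (zero_lt_one (α := ℝ)))] with t hanti ht0 ht1 w hw
  have ht0' : 0 ≤ t := le_of_lt ht0
  have ht1' : t ≤ 1 := ht1
  have hmc := (s.contDiff_map t).continuous
  have hDw : Continuous (fderiv ℝ w) := hw.continuous_fderiv (by simp)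
  have e1 := eLpNorm_comp_antilipschitz_le hanti hmc hw.continuous
  have e2 := eLpNorm_comp_antilipschitz_le hanti hmc hDw
  have p1 : ∀ x, ‖s.pull t w x‖ ≤ a * ‖w (s.map t x)‖ := by
    intro x
    calc ‖s.pull t w x‖ ≤ ‖w (s.map t x)‖ + 1 * (m * ‖w (s.map t x)‖) := by
          refine (norm_add_le _ _).trans ?_
          rw [norm_smul, Real.norm_of_nonneg ht0']
          gcongr
          exact ContinuousLinearMap.le_of_opNorm_le _ (hm x) _
      _ = _ := by ring
  have pA : ∀ x, ‖s.mapDeriv t x‖ ≤ 1 + m'' * ‖s.e‖ := by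
    intro x
    refine (norm_sub_le _ _).trans ?_
    rw [norm_smul, Real.norm_of_nonneg ht0', ContinuousLinearMap.norm_smulRight_apply]
    calc _ ≤ 1 + 1 * (m'' * ‖s.e‖) := by
          gcongr
          · exact ContinuousLinearMap.norm_id_le
          · exact hm'' x
      _ = _ := by ring
  have p2 : ∀ x, ‖fderiv ℝ (s.pull t w) x‖ ≤
      b * ‖fderiv ℝ w (s.map t x)‖ + d * ‖w (s.map t x)‖ := by
    intro x
    rw [s.fderiv_pull t hw]
    have q1 : ‖fderiv ℝ w (s.map t x) ∘L s.mapDeriv t x‖ ≤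
        ‖fderiv ℝ w (s.map t x)‖ * (1 + m'' * ‖s.e‖) :=
      (ContinuousLinearMap.opNorm_comp_le _ _).trans (by gcongr; exact pA x)
    have q2 : ‖s.adj (fderiv ℝ s.φ x) ∘L (fderiv ℝ w (s.map t x) ∘L s.mapDeriv t x)‖ ≤
        m * (‖fderiv ℝ w (s.map t x)‖ * (1 + m'' * ‖s.e‖)) :=
      (ContinuousLinearMap.opNorm_comp_le _ _).trans
        (mul_le_mul (hm x) q1 (norm_nonneg _) hm0)
    have q3 : ‖(s.adj ∘L fderiv ℝ (fderiv ℝ s.φ) x).flip (w (s.map t x))‖ ≤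
        d * ‖w (s.map t x)‖ := by
      refine (ContinuousLinearMap.le_opNorm _ _).trans ?_
      rw [ContinuousLinearMap.opNorm_flip]
      gcongr
      exact (ContinuousLinearMap.opNorm_comp_le _ _).trans 
        (mul_le_mul_of_nonneg_left (hm' x) (norm_nonneg _))
    calc _ ≤ ‖fderiv ℝ w (s.map t x)‖ * (1 + m'' * ‖s.e‖) +
          1 * (m * (‖fderiv ℝ w (s.map t x)‖ * (1 + m'' * ‖s.e‖)) + d * ‖w (s.map t x)‖) := by
          refine (norm_add_le _ _).trans (add_le_add q1 ?_)
          rw [norm_smul, Real.norm_of_nonneg ht0']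
          gcongr
          exact (norm_add_le _ _).trans (add_le_add q2 q3)
      _ = _ := by ring
  have E1 : eLpNorm (s.pull t w) 2 volume ≤ ENNReal.ofReal a * (c * eLpNorm w 2 volume) :=
    (eLpNorm_le_mul_eLpNorm_of_ae_le_mul (Eventually.of_forall p1) 2).trans (by gcongr)
  have E2 : eLpNorm (fderiv ℝ (s.pull t w)) 2 volume ≤
      ENNReal.ofReal b * (c * eLpNorm (fderiv ℝ w) 2 volume) +
        ENNReal.ofReal d * (c * eLpNorm w 2 volume) := by
    have hb0 : 0 ≤ b := by positivity
    have hd0 : 0 ≤ d := by positivity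
    have f1 : eLpNorm (fderiv ℝ (s.pull t w)) 2 volume ≤
        eLpNorm ((fun x => b * ‖fderiv ℝ w (s.map t x)‖) + fun x => d * ‖w (s.map t x)‖) 2 volume :=
      eLpNorm_mono_real p2
    refine f1.trans ((eLpNorm_add_le ?_ ?_ (by norm_num)).trans (add_le_add ?_ ?_))
    · exact (continuous_const.mul (hDw.comp hmc).norm).aestronglyMeasurable
    · exact (continuous_const.mul (hw.continuous.comp hmc).norm).aestronglyMeasurable
    · refine (eLpNorm_le_mul_eLpNorm_of_ae_le_mul (c := b) (g := fun x => fderiv ℝ w (s.map t x))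
        (Eventually.of_forall fun x => ?_) 2).trans (by gcongr)
      rw [Real.norm_of_nonneg (by positivity)]
    · refine (eLpNorm_le_mul_eLpNorm_of_ae_le_mul (c := d) (g := fun x => w (s.map t x))
        (Eventually.of_forall fun x => ?_) 2).trans (by gcongr)
      rw [Real.norm_of_nonneg (by positivity)]
  unfold hNorm
  set N1 := eLpNorm w 2 volume
  set N2 := eLpNorm (fderiv ℝ w) 2 volume
  push_cast
  calc _ ≤ _ := add_le_add E1 E2
    _ = ((ENNReal.ofReal a + ENNReal.ofReal d) * c) * N1 + (ENNReal.ofReal b * c) * N2 := by ring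
    _ ≤ ((ENNReal.ofReal a + ENNReal.ofReal b + ENNReal.ofReal d) * c) * N1 +
        ((ENNReal.ofReal a + ENNReal.ofReal b + ENNReal.ofReal d) * c) * N2 := by
      gcongr
      · exact le_self_add
      · exact le_add_right le_add_self
    _ = _ := by rw [← mul_add]; rfl

/-- The Piola transforms converge to the identity on test fields. -/
lemma tendsto_hNorm_pull_sub {w : Vec → Vec} (hw : IsTest Set.univ w) :
    Tendsto (fun t => hNorm (s.pull t w - w)) (𝓝[>] 0) (𝓝 0) := by
  obtain ⟨m, hm0, hm⟩ := exists_bound (s.isTest.fderiv.clm_comp s.adj)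
  obtain ⟨m', hm0', hm'⟩ := exists_bound s.isTest.fderiv.fderiv
  obtain ⟨m'', hm0'', hm''⟩ := exists_bound s.isTest.fderiv
  obtain ⟨q, hq0, hq⟩ := exists_bound s.isTest
  obtain ⟨B₀, hB₀0, hB₀⟩ := exists_bound hw
  obtain ⟨B₁, hB₁0, hB₁⟩ := exists_bound hw.fderiv
  obtain ⟨K₁, hK₁⟩ := ContDiff.lipschitzWith_of_hasCompactSupport hw.compact hw.smooth (by simp)
  obtain ⟨K₂, hK₂⟩ :=
    ContDiff.lipschitzWith_of_hasCompactSupport hw.fderiv.compact hw.fderiv.smooth (by simp)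
  let C₀ : ℝ := K₁ * (q * ‖s.e‖) + m * B₀
  let C₁ : ℝ := K₂ * (q * ‖s.e‖) + B₁ * (m'' * ‖s.e‖) +
    (m * (B₁ * (1 + m'' * ‖s.e‖)) + ‖s.adj‖ * m' * B₀)
  -- The difference and its derivative vanish off the compact support of `φ` and are pointwise O(t),
  -- because `w` and its derivative are bounded and Lipschitz.
  have hbound : ∀ᶠ t in 𝓝[>] (0 : ℝ), hNorm (s.pull t w - w) ≤
      volume (tsupport s.φ) ^ (2 : ℝ)⁻¹ * ENNReal.ofReal (t * C₀) +
        volume (tsupport s.φ) ^ (2 : ℝ)⁻¹ * ENNReal.ofReal (t * C₁) := by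
    filter_upwards [self_mem_nhdsWithin,
      nhdsWithin_le_nhds (Iic_mem_nhds (zero_lt_one (α := ℝ)))] with t ht0 ht1
    have ht0' : 0 ≤ t := le_of_lt ht0
    have ht1' : t ≤ 1 := ht1
    have hsupp : Function.support (s.pull t w - w) ⊆ tsupport s.φ := by
      intro x hx
      by_contra hxφ
      have h1 : s.φ x = 0 := image_eq_zero_of_notMem_tsupport hxφ
      have h2 : fderiv ℝ s.φ x = 0 :=
        image_eq_zero_of_notMem_tsupport fun h => hxφ (tsupport_fderiv_subset ℝ h)
      exact hx (by simp [pull, map, h1, h2])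
    have hsupp' : Function.support (fderiv ℝ (s.pull t w - w)) ⊆ tsupport s.φ :=
      (support_fderiv_subset ℝ).trans (closure_minimal hsupp (isClosed_tsupport _))
    have hdist : ∀ x, dist (s.map t x) x ≤ t * (q * ‖s.e‖) := by
      intro x
      rw [dist_eq_norm, map, sub_sub_cancel_left, norm_neg, norm_smul, norm_mul,
        Real.norm_of_nonneg ht0', mul_assoc]
      gcongr
      exact hq x
    refine add_le_add
      (eLpNorm_le_of_support_subset (isClosed_tsupport _).measurableSet hsupp fun x => ?_)
      (eLpNorm_le_of_support_subset (isClosed_tsupport _).measurableSet hsupp' fun x => ?_)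
    · have h1 : (s.pull t w - w) x = (w (s.map t x) - w x) +
          t • s.adj (fderiv ℝ s.φ x) (w (s.map t x)) := by
        simp only [pull, Pi.sub_apply]; abel
      rw [h1]
      calc _ ≤ K₁ * (t * (q * ‖s.e‖)) + t * (m * B₀) := by
            refine (norm_add_le _ _).trans (add_le_add ?_ ?_)
            · rw [← dist_eq_norm]
              exact (hK₁.dist_le_mul _ _).trans (by gcongr; exact hdist x)
            · rw [norm_smul, Real.norm_of_nonneg ht0']
              gcongr
              exact (ContinuousLinearMap.le_opNorm _ _).trans
                (mul_le_mul (hm x) (hB₀ _) (norm_nonneg _) hm0)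
        _ = t * C₀ := by ring
    · have hd : fderiv ℝ (s.pull t w - w) x = fderiv ℝ (s.pull t w) x - fderiv ℝ w x :=
        fderiv_sub ((s.contDiff_pull t hw.smooth).differentiable (by simp) x)
          (hw.smooth.differentiable (by simp) x)
      have hA : fderiv ℝ w (s.map t x) ∘L s.mapDeriv t x = fderiv ℝ w (s.map t x) -
          t • (fderiv ℝ w (s.map t x) ∘L (fderiv ℝ s.φ x).smulRight s.e) := by
        ext1 v
        simp [mapDeriv]
      have hn : ‖(fderiv ℝ s.φ x).smulRight s.e‖ ≤ m'' * ‖s.e‖ := by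
        rw [ContinuousLinearMap.norm_smulRight_apply]
        gcongr
        exact hm'' x
      have q0 : ‖fderiv ℝ w (s.map t x) ∘L (fderiv ℝ s.φ x).smulRight s.e‖ ≤
          B₁ * (m'' * ‖s.e‖) :=
        (ContinuousLinearMap.opNorm_comp_le _ _).trans
          (mul_le_mul (hB₁ _) hn (norm_nonneg _) hB₁0)
      have q1 : ‖fderiv ℝ w (s.map t x) ∘L s.mapDeriv t x‖ ≤ B₁ * (1 + m'' * ‖s.e‖) := by
        rw [hA]
        refine (norm_sub_le _ _).trans ?_
        rw [norm_smul, Real.norm_of_nonneg ht0']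
        calc _ ≤ B₁ + 1 * (B₁ * (m'' * ‖s.e‖)) := by
              gcongr
              exact hB₁ _
          _ = _ := by ring
      have q2 : ‖s.adj (fderiv ℝ s.φ x) ∘L (fderiv ℝ w (s.map t x) ∘L s.mapDeriv t x)‖ ≤
          m * (B₁ * (1 + m'' * ‖s.e‖)) :=
        (ContinuousLinearMap.opNorm_comp_le _ _).trans
          (mul_le_mul (hm x) q1 (norm_nonneg _) hm0)
      have q3 : ‖(s.adj ∘L fderiv ℝ (fderiv ℝ s.φ) x).flip (w (s.map t x))‖ ≤
          ‖s.adj‖ * m' * B₀ := by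
        refine (ContinuousLinearMap.le_opNorm _ _).trans ?_
        rw [ContinuousLinearMap.opNorm_flip]
        refine mul_le_mul ?_ (hB₀ _) (norm_nonneg _) (by positivity)
        exact (ContinuousLinearMap.opNorm_comp_le _ _).trans
          (mul_le_mul_of_nonneg_left (hm' x) (norm_nonneg _))
      have hrw : fderiv ℝ (s.pull t w - w) x = (fderiv ℝ w (s.map t x) - fderiv ℝ w x) -
          t • (fderiv ℝ w (s.map t x) ∘L (fderiv ℝ s.φ x).smulRight s.e) +
          t • (s.adj (fderiv ℝ s.φ x) ∘L (fderiv ℝ w (s.map t x) ∘L s.mapDeriv t x) +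
            (s.adj ∘L fderiv ℝ (fderiv ℝ s.φ) x).flip (w (s.map t x))) := by
        rw [hd, s.fderiv_pull t hw.smooth]
        nth_rewrite 1 [hA]
        abel
      rw [hrw]
      calc _ ≤ K₂ * (t * (q * ‖s.e‖)) + t * (B₁ * (m'' * ‖s.e‖)) +
            t * (m * (B₁ * (1 + m'' * ‖s.e‖)) + ‖s.adj‖ * m' * B₀) := by
            refine (norm_add_le _ _).trans (add_le_add
              ((norm_sub_le _ _).trans (add_le_add ?_ ?_)) ?_)
            · rw [← dist_eq_norm]
              exact (hK₂.dist_le_mul _ _).trans (by gcongr; exact hdist x)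
            · rw [norm_smul, Real.norm_of_nonneg ht0']
              gcongr
            · rw [norm_smul, Real.norm_of_nonneg ht0']
              gcongr
              exact (norm_add_le _ _).trans (add_le_add q2 q3)
        _ = t * C₁ := by ring
  have hvol : volume (tsupport s.φ) ^ (2 : ℝ)⁻¹ ≠ ⊤ :=
    ENNReal.rpow_ne_top_of_nonneg (by norm_num) s.compact.measure_lt_top.ne
  have hlim : ∀ C : ℝ, Tendsto (fun t : ℝ => volume (tsupport s.φ) ^ (2 : ℝ)⁻¹ *
      ENNReal.ofReal (t * C)) (𝓝[>] 0) (𝓝 0) := by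
    intro C
    have h1 : Tendsto (fun t : ℝ => t * C) (𝓝[>] 0) (𝓝 (0 * C)) :=
      (tendsto_nhdsWithin_of_tendsto_nhds tendsto_id).mul_const _
    have h2 := ENNReal.Tendsto.const_mul (ENNReal.tendsto_ofReal h1) (Or.inr hvol)
    simpa using h2
  have h0 := (hlim C₀).add (hlim C₁)
  rw [add_zero] at h0
  exact tendsto_of_tendsto_of_tendsto_of_le_of_le' tendsto_const_nhds h0
    (Eventually.of_forall fun _ => zero_le) hbound

end Shear

namespace Shear

/-! ### Compositions of shears -/

/-- Composition of the shears of a list, with a common parameter. -/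
def mapList : List Shear → ℝ → Vec → Vec
  | [], _, x => x
  | s :: L, t, x => mapList L t (s.map t x)

/-- Composition of the Piola transforms of a list of shears. -/
def pullList : List Shear → ℝ → (Vec → Vec) → Vec → Vec
  | [], _, w => w
  | s :: L, t, w => s.pull t (pullList L t w)

lemma contDiff_mapList (t : ℝ) : ∀ L : List Shear, ContDiff ℝ ∞ (mapList L t)
  | [] => contDiff_id
  | s :: L => (contDiff_mapList t L).comp (s.contDiff_map t)

lemma contDiff_pullList (t : ℝ) {w : Vec → Vec} (hw : ContDiff ℝ ∞ w) :
    ∀ L : List Shear, ContDiff ℝ ∞ (pullList L t w)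
  | [] => hw
  | s :: L => s.contDiff_pull t (contDiff_pullList t hw L)

lemma div_pullList (t : ℝ) {w : Vec → Vec} (hw : ContDiff ℝ ∞ w)
    (hdiv : ∀ x, traceGrad (classicalGrad w x) = 0) :
    ∀ (L : List Shear) (x : Vec), traceGrad (classicalGrad (pullList L t w) x) = 0
  | [], x => hdiv x
  | s :: L, x => s.div_pull t (contDiff_pullList t hw L) (div_pullList t hw hdiv L) x

lemma pullList_sub (t : ℝ) (v w : Vec → Vec) :
    ∀ L : List Shear, pullList L t (v - w) = pullList L t v - pullList L t w
  | [] => rfl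
  | s :: L => by simp only [pullList, pullList_sub t v w L, s.pull_sub]

lemma pullList_eq_zero (t : ℝ) {w : Vec → Vec} :
    ∀ (L : List Shear) {x : Vec}, w (mapList L t x) = 0 → pullList L t w x = 0
  | [], _, h => h
  | s :: L, _, h => s.pull_eq_zero t (pullList_eq_zero t L h)

lemma antilipschitz_mapList : ∀ L : List Shear, ∃ K : ℝ≥0,
    ∀ᶠ t in 𝓝[>] (0 : ℝ), AntilipschitzWith K (mapList L t)
  | [] => ⟨1, Eventually.of_forall fun _ => AntilipschitzWith.id⟩
  | s :: L => by
    obtain ⟨K, hK⟩ := antilipschitz_mapList L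
    refine ⟨2 * K, ?_⟩
    filter_upwards [hK, s.antilipschitz_map] with t h1 h2
    exact h1.comp h2

lemma uniformContinuous_map (s : Shear) (t : ℝ) : UniformContinuous (s.map t) := by
  have h1 : UniformContinuous s.φ :=
    s.compact.uniformContinuous_of_continuous s.smooth.continuous
  have h2 : UniformContinuous fun x => (t • ContinuousLinearMap.toSpanSingleton ℝ s.e) (s.φ x) :=
    (t • ContinuousLinearMap.toSpanSingleton ℝ s.e).uniformContinuous.comp h1
  have h3 : s.map t = fun x => id x - (t • ContinuousLinearMap.toSpanSingleton ℝ s.e) (s.φ x) := by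
    ext1 x
    simp [map, smul_smul]
  rw [h3]
  exact uniformContinuous_id.sub h2

lemma uniformContinuous_mapList (t : ℝ) : ∀ L : List Shear, UniformContinuous (mapList L t)
  | [] => uniformContinuous_id
  | s :: L => (uniformContinuous_mapList t L).comp (s.uniformContinuous_map t)

lemma hNorm_pullList_le : ∀ L : List Shear, ∃ C : ℝ≥0, ∀ᶠ t in 𝓝[>] (0 : ℝ),
    ∀ w : Vec → Vec, ContDiff ℝ ∞ w → hNorm (pullList L t w) ≤ C * hNorm w
  | [] => ⟨1, Eventually.of_forall fun _ w _ => by simp [pullList]⟩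
  | s :: L => by
    obtain ⟨C, hC⟩ := hNorm_pullList_le L
    obtain ⟨C', hC'⟩ := s.hNorm_pull_le
    refine ⟨C' * C, ?_⟩
    filter_upwards [hC, hC'] with t h1 h2 w hw
    refine (h2 _ (contDiff_pullList t hw L)).trans ?_
    rw [ENNReal.coe_mul, mul_assoc]
    gcongr
    exact h1 w hw

/-- Split off the outermost transform `s.pull`: its effect on the error of the remaining list is
controlled by the uniform bound `hNorm_pull_le`, and its own error by convergence for a single
shear. -/
lemma tendsto_hNorm_pullList_sub {w : Vec → Vec} (hw : IsTest Set.univ w) : ∀ L : List Shear,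
    Tendsto (fun t => hNorm (pullList L t w - w)) (𝓝[>] 0) (𝓝 0)
  | [] => by
    have h : hNorm 0 = 0 := by
      have h0 : fderiv ℝ (0 : Vec → Vec) = 0 := fderiv_zero
      have h1 := eLpNorm_le_of_support_subset (f := fderiv ℝ (0 : Vec → Vec)) (K := ∅) (C := 0)
        MeasurableSet.empty (by simp [h0]) (fun x => by simp [h0])
      rw [ENNReal.ofReal_zero, mul_zero] at h1
      rw [hNorm, eLpNorm_zero, zero_add]
      exact le_antisymm h1 zero_le
    simp [pullList, h]
  | s :: L => by
    obtain ⟨C, hC⟩ := s.hNorm_pull_le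
    have h1 : Tendsto (fun t => C * hNorm (pullList L t w - w) + hNorm (s.pull t w - w))
        (𝓝[>] 0) (𝓝 0) := by
      have := (ENNReal.Tendsto.const_mul (a := C) (tendsto_hNorm_pullList_sub hw L)
        (Or.inr (by simp))).add (s.tendsto_hNorm_pull_sub hw)
      simpa using this
    refine tendsto_of_tendsto_of_tendsto_of_le_of_le' tendsto_const_nhds h1
      (Eventually.of_forall fun _ => zero_le) ?_
    filter_upwards [hC] with t ht
    have h2 : pullList (s :: L) t w - w = s.pull t (pullList L t w - w) + (s.pull t w - w) := by
      rw [pull_sub, pullList]; abel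
    rw [h2]
    have h3 : ContDiff ℝ ∞ (pullList L t w - w) := (contDiff_pullList t hw.smooth L).sub hw.smooth
    have h4 : ContDiff ℝ ∞ (s.pull t w - w) := (s.contDiff_pull t hw.smooth).sub hw.smooth
    refine (hNorm_add_le (s.contDiff_pull t h3) h4).trans ?_
    gcongr
    exact ht _ h3

/-! ### Pushing the complement of a Lipschitz domain away from its closure -/

/-- A shear moves points outside of `Ω` away from `closure Ω`. -/
def Expels (Ω : Set Vec) (s : Shear) (t : ℝ) : Prop :=
  ∀ x ∉ Ω, s.φ x ≠ 0 → s.map t x ∉ closure Ω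

/-- A point is fixed until the first shear active at it, which throws it out of the closure. Later
shears either fix it or expel it again, so it never returns. -/
lemma mapList_notMem_closure {Ω : Set Vec} {t : ℝ} : ∀ {L : List Shear},
    (∀ s ∈ L, s.Expels Ω t) → ∀ {x : Vec}, x ∉ Ω → (x ∉ closure Ω ∨ ∃ s ∈ L, s.φ x ≠ 0) →
      mapList L t x ∉ closure Ω
  | [], _, x, _, h => by
    rcases h with h | ⟨s, hs, -⟩
    · exact h
    · simp at hs
  | s :: L, hL, x, hx, h => by
    have hL' : ∀ s ∈ L, s.Expels Ω t := fun s' hs' => hL s' (List.mem_cons_of_mem _ hs')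
    rw [mapList]
    by_cases hφ : s.φ x = 0
    · have hmap : s.map t x = x := by simp [map, hφ]
      rw [hmap]
      refine mapList_notMem_closure hL' hx (h.imp_right ?_)
      rintro ⟨s', hs', hne⟩
      rcases List.mem_cons.1 hs' with rfl | hs'
      · exact absurd hφ hne
      · exact ⟨s', hs', hne⟩
    · have h1 := hL s List.mem_cons_self x hx hφ
      exact mapList_notMem_closure hL' (fun h2 => h1 (subset_closure h2)) (Or.inl h1)

/-- In the chart `Ω` lies strictly above the graph, so a point outside lies on or below it. Any
downward shift puts it strictly below the graph, in an open set disjoint from `Ω`. Only continuity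
of the graph function is used. -/
lemma exists_expels {Ω : Set Vec} (hΩ : HasLipschitzBoundary Ω) {x₀ : Vec}
    (hx₀ : x₀ ∈ frontier Ω) :
    ∃ s : Shear, s.φ x₀ ≠ 0 ∧ ∀ᶠ t in 𝓝[>] (0 : ℝ), s.Expels Ω t := by
  obtain ⟨r, hr, R, K, γ, hγ, hchart⟩ := hΩ x₀ hx₀
  let b : ContDiffBump x₀ := ⟨r / 4, r / 2, by positivity, by linarith⟩
  let e : Vec := R.symm (EuclideanSpace.single 2 1)
  have he : ‖e‖ = 1 := by simp [e]
  refine ⟨⟨b, e, b.contDiff, b.hasCompactSupport⟩, ?_, ?_⟩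
  · have : b x₀ = 1 := b.one_of_mem_closedBall (by simp [b.rIn_pos.le])
    simp [this]
  -- The amplitude is supported in the ball of radius `r / 2` and displacements have length at most
  -- `t ≤ r / 2`, so the image stays in the chart ball.
  filter_upwards [self_mem_nhdsWithin,
    nhdsWithin_le_nhds (Iic_mem_nhds (by positivity : (0 : ℝ) < r / 2))] with t ht0 ht1 x hx hφ
  have ht0' : 0 < t := ht0
  have ht1' : t ≤ r / 2 := ht1
  change b x ≠ 0 at hφ
  have hb0 : 0 < b x := lt_of_le_of_ne b.nonneg hφ.symm
  have hxr : dist x x₀ < r / 2 := by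
    have : x ∈ Function.support b := hφ
    rwa [b.support_eq] at this
  change x - (t * b x) • e ∉ closure Ω
  set y := x - (t * b x) • e
  have hyr : y ∈ Metric.ball x₀ r := by
    rw [Metric.mem_ball]
    have h1 : dist y x ≤ t := by
      rw [dist_eq_norm, sub_sub_cancel_left, norm_neg, norm_smul, he, mul_one,
        Real.norm_of_nonneg (by positivity)]
      exact mul_le_of_le_one_right ht0'.le b.le_one
    linarith [dist_triangle y x x₀]
  have hRy : R y = R x - (t * b x) • EuclideanSpace.single 2 1 := by
    simp [y, e]
  have hγc : Continuous fun z : Vec => γ !₂[R z 0, R z 1] := by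
    refine hγ.continuous.comp ?_
    refine (PiLp.continuous_toLp 2 _).comp (continuous_pi fun i => ?_)
    fin_cases i
    · exact (EuclideanSpace.proj (0 : Fin 3)).continuous.comp R.continuous
    · exact (EuclideanSpace.proj (1 : Fin 3)).continuous.comp R.continuous
  have hU : IsOpen (Metric.ball x₀ r ∩ {z : Vec | R z 2 < γ !₂[R z 0, R z 1]}) :=
    Metric.isOpen_ball.inter (isOpen_lt
      ((EuclideanSpace.proj (2 : Fin 3)).continuous.comp R.continuous) hγc)
  have hxγ : R x 2 ≤ γ !₂[R x 0, R x 1] := by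
    by_contra h
    refine hx ((hchart x ?_).2 (not_le.1 h))
    exact Metric.mem_ball.2 (by linarith)
  have hyU : y ∈ Metric.ball x₀ r ∩ {z : Vec | R z 2 < γ !₂[R z 0, R z 1]} := by
    refine ⟨hyr, ?_⟩
    change R y 2 < γ !₂[R y 0, R y 1]
    have h0 : R y 0 = R x 0 := by simp [hRy]
    have h1 : R y 1 = R x 1 := by simp [hRy]
    have h2 : R y 2 = R x 2 - t * b x := by simp [hRy]
    rw [h0, h1, h2]
    have : 0 < t * b x := by positivity
    linarith
  intro hy
  obtain ⟨z, ⟨hz1, hz2⟩, hz3⟩ := mem_closure_iff.1 hy _ hU hyU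
  exact lt_asymm hz2 ((hchart z hz1).1 hz3)

/-- Around a bounded Lipschitz domain, compositions of small shears map the complement of the domain
into the complement of its closure. -/
lemma exists_list_expels {Ω : Set Vec} (hΩ : HasLipschitzBoundary Ω)
    (hb : Bornology.IsBounded Ω) : ∃ L : List Shear, ∀ᶠ t in 𝓝[>] (0 : ℝ),
      ∀ x ∉ Ω, mapList L t x ∉ closure Ω := by
  have hcomp : IsCompact (frontier Ω) :=
    hb.isCompact_closure.of_isClosed_subset isClosed_frontier frontier_subset_closure
  obtain ⟨L, hL, hcov⟩ : ∃ L : List Shear, (∀ s ∈ L, ∀ᶠ t in 𝓝[>] (0 : ℝ), s.Expels Ω t) ∧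
      ∀ x ∈ frontier Ω, ∃ s ∈ L, s.φ x ≠ 0 := by
    refine hcomp.induction_on (p := fun S => ∃ L : List Shear,
      (∀ s ∈ L, ∀ᶠ t in 𝓝[>] (0 : ℝ), s.Expels Ω t) ∧ ∀ x ∈ S, ∃ s ∈ L, s.φ x ≠ 0) ?_ ?_ ?_ ?_
    · exact ⟨[], by simp, by simp⟩
    · rintro S T hST ⟨L, h1, h2⟩
      exact ⟨L, h1, fun x hx => h2 x (hST hx)⟩
    · rintro S T ⟨L, h1, h2⟩ ⟨L', h1', h2'⟩
      refine ⟨L ++ L', fun s hs => (List.mem_append.1 hs).elim (h1 s) (h1' s), fun x hx => ?_⟩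
      rcases hx with hx | hx
      · obtain ⟨s, hs, h⟩ := h2 x hx
        exact ⟨s, List.mem_append_left _ hs, h⟩
      · obtain ⟨s, hs, h⟩ := h2' x hx
        exact ⟨s, List.mem_append_right _ hs, h⟩
    · intro x hx
      obtain ⟨s, hs, hexp⟩ := exists_expels hΩ hx
      refine ⟨{y | s.φ y ≠ 0}, mem_nhdsWithin_of_mem_nhds
        ((isOpen_ne_fun s.smooth.continuous continuous_const).mem_nhds hs), [s], ?_, ?_⟩
      · simpa using hexp
      · intro y hy
        exact ⟨s, by simp, hy⟩
  refine ⟨L, ?_⟩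
  have hL' := (eventually_all_finite (List.finite_toSet L)).2 hL
  filter_upwards [hL'] with t ht x hx
  refine mapList_notMem_closure ht hx ?_
  by_cases hxc : x ∈ closure Ω
  · exact Or.inr (hcov x ⟨hxc, fun h => hx (interior_subset h)⟩)
  · exact Or.inl hxc

end Shear

/-! ### Density of solenoidal test fields -/

/-- Mollifications converge in `L²`. -/
lemma exists_eLpNorm_moll_sub_le {F : Type*} [NormedAddCommGroup F] [NormedSpace ℝ F]
    [FiniteDimensional ℝ F] {f : Vec → F} (hf : MemLp f 2 volume) {δ : ℝ} (hδ : 0 < δ) :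
    ∃ r₀ : ℝ, 0 < r₀ ∧ ∀ ρ : ContDiffBump (0 : Vec), ρ.rOut ≤ r₀ →
      eLpNorm (moll ρ f - f) 2 volume ≤ ENNReal.ofReal δ := by
  have : CompleteSpace F := FiniteDimensional.complete ℝ F
  -- Three-term argument: mollification contracts L², so replacing `f` by a smooth `g` costs `δ / 3`
  -- on either side, and for `g` the linear rate in the radius applies.
  obtain ⟨g, hgc, hgs, hfg⟩ := hf.exist_eLpNorm_sub_le (by norm_num) (by norm_num)
    (ε := δ / 3) (by positivity)
  have hg : IsTest Set.univ g := ⟨hgs, hgc, Set.subset_univ _⟩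
  set N := (eLpNorm (fderiv ℝ g) 2 volume).toReal
  have hN : 0 ≤ N := ENNReal.toReal_nonneg
  refine ⟨δ / 3 / (N + 1), by positivity, fun ρ hρ => ?_⟩
  have hgm := hg.memLp 2 volume
  have hfl : LocallyIntegrable f volume := hf.locallyIntegrable (by norm_num)
  have hgl : LocallyIntegrable g volume := hgm.locallyIntegrable (by norm_num)
  have hmc : ∀ {u : Vec → F}, LocallyIntegrable u volume →
      AEStronglyMeasurable (moll ρ u) volume := fun hu =>
    (contDiff_moll ρ hu).continuous.aestronglyMeasurable
  have h1 : moll ρ f - f = moll ρ (f - g) + ((moll ρ g - g) + (g - f)) := by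
    rw [moll_sub ρ hfl hgl]; abel
  have h2 : eLpNorm (moll ρ (f - g)) 2 volume ≤ ENNReal.ofReal (δ / 3) :=
    (eLpNorm_moll_le ρ (hf.sub hgm).1).trans hfg
  have h3 : eLpNorm (moll ρ g - g) 2 volume ≤ ENNReal.ofReal (δ / 3) := by
    refine (hg.eLpNorm_moll_sub_le ρ).trans ?_
    rw [← ENNReal.ofReal_toReal (hg.fderiv.memLp 2 volume).eLpNorm_ne_top,
      ← ENNReal.ofReal_mul ρ.rOut_pos.le]
    refine ENNReal.ofReal_le_ofReal ?_
    calc ρ.rOut * N ≤ δ / 3 / (N + 1) * (N + 1) := by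
          gcongr
          linarith
      _ = δ / 3 := div_mul_cancel₀ _ (by positivity)
  have h4 : eLpNorm (g - f) 2 volume ≤ ENNReal.ofReal (δ / 3) := by
    rwa [eLpNorm_sub_comm]
  rw [h1]
  refine (eLpNorm_add_le (hmc (hfl.sub hgl)) (((hmc hgl).sub hgm.1).add (hgm.sub hf).1)
    (by norm_num)).trans ?_
  calc _ ≤ ENNReal.ofReal (δ / 3) + (ENNReal.ofReal (δ / 3) + ENNReal.ofReal (δ / 3)) :=
        add_le_add h2 ((eLpNorm_add_le ((hmc hgl).sub hgm.1) (hgm.sub hf).1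
          (by norm_num)).trans (add_le_add h3 h4))
    _ = ENNReal.ofReal δ := by
        rw [← ENNReal.ofReal_add (by positivity) (by positivity),
          ← ENNReal.ofReal_add (by positivity) (by positivity)]
        congr 1
        ring

section

variable {Ω : Set Vec}

lemma clm_moll {F G : Type*} [NormedAddCommGroup F] [NormedSpace ℝ F] [CompleteSpace F]
    [NormedAddCommGroup G] [NormedSpace ℝ G] [CompleteSpace G] (A : F →L[ℝ] G)
    (ρ : ContDiffBump (0 : Vec)) {u : Vec → F} (hu : LocallyIntegrable u volume) (x : Vec) :
    A (moll ρ u x) = moll ρ (fun y => A (u y)) x := by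
  have hint : Integrable (fun y => ρ.normed volume y • u (x - y)) volume :=
    ρ.hasCompactSupport_normed.convolutionExists_left
      (ContinuousLinearMap.lsmul ℝ ℝ) ρ.continuous_normed hu x
  simp only [moll, convolution_def, ContinuousLinearMap.lsmul_apply]
  rw [← A.integral_comp_comm hint]
  simp

/-- The extension of a field in `X` by zero. -/
def X.ext (V : X Ω) : Vec → Vec := Ω.indicator V.val

/-- The extension of the gradient by zero. -/
def X.extGrad (V : X Ω) : Vec → Grad := Ω.indicator V.grad

lemma X.memLp_ext (hΩ : MeasurableSet Ω) (V : X Ω) : MemLp V.ext 2 volume :=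
  (memLp_indicator_iff_restrict hΩ).2 (Lp.memLp V.val)

lemma X.memLp_extGrad (hΩ : MeasurableSet Ω) (V : X Ω) : MemLp V.extGrad 2 volume :=
  (memLp_indicator_iff_restrict hΩ).2 (Lp.memLp V.grad)

/-- Convolution commutes with the weak gradient of the extension by zero, available on all of space
by `H10_integral_by_parts`. So mollified gradients converge and mollified fields stay solenoidal. -/
lemma X.classicalGrad_moll (hΩ : MeasurableSet Ω) (V : X Ω) (ρ : ContDiffBump (0 : Vec)) (x : Vec) :
    classicalGrad (moll ρ V.ext) x = moll ρ V.extGrad x := by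
  have h1 : LocallyIntegrable V.ext volume := (V.memLp_ext hΩ).locallyIntegrable (by norm_num)
  have h2 : LocallyIntegrable V.extGrad volume :=
    (V.memLp_extGrad hΩ).locallyIntegrable (by norm_num)
  ext j : 1
  have h3 := clm_moll (PiLp.proj 2 (fun _ : Fin 3 => Vec) j : Grad →L[ℝ] Vec) ρ h2 x
  refine Eq.trans ?_ h3.symm
  refine pderiv_moll ρ h1 (fun φ hφ => ?_) x
  have h4 := H10_integral_by_parts (p := V.1) V.2.1 hφ j
  have e1 : ∀ x, pderiv φ j x • V.ext x = Ω.indicator (fun x => pderiv φ j x • V.val x) x := by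
    intro x
    by_cases hx : x ∈ Ω <;> simp [X.ext, hx]
  have e2 : ∀ x, φ x • V.extGrad x j = Ω.indicator (fun x => φ x • V.grad x j) x := by
    intro x
    by_cases hx : x ∈ Ω <;> simp [X.extGrad, hx]
  simp only [PiLp.proj_apply, e1, e2, integral_indicator hΩ]
  exact h4

lemma X.div_moll (hΩ : MeasurableSet Ω) (V : X Ω) (ρ : ContDiffBump (0 : Vec)) (x : Vec) :
    traceGrad (classicalGrad (moll ρ V.ext) x) = 0 := by
  have h2 : LocallyIntegrable V.extGrad volume :=
    (V.memLp_extGrad hΩ).locallyIntegrable (by norm_num)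
  rw [V.classicalGrad_moll hΩ, ← traceGradL_apply, clm_moll traceGradL ρ h2,
    moll_eq_integral_swap]
  refine integral_eq_zero_of_ae ?_
  filter_upwards [(ae_restrict_iff' hΩ).1 V.2.2] with y hy
  by_cases hyΩ : y ∈ Ω
  · have h3 : traceGrad (V.grad y) = 0 := hy hyΩ
    simp [X.extGrad, hyΩ, traceGradL_apply, h3]
  · simp [X.extGrad, hyΩ]

lemma X.isTest_moll (hΩ : MeasurableSet Ω) (hb : Bornology.IsBounded Ω) (V : X Ω)
    (ρ : ContDiffBump (0 : Vec)) :
    IsTest (Metric.cthickening ρ.rOut (closure Ω)) (moll ρ V.ext) := by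
  have h1 : tsupport (moll ρ V.ext) ⊆ Metric.cthickening ρ.rOut (closure Ω) :=
    closure_minimal (support_moll_subset ρ _
      (Set.support_indicator_subset.trans subset_closure)) Metric.isClosed_cthickening
  exact ⟨contDiff_moll ρ ((V.memLp_ext hΩ).locallyIntegrable (by norm_num)),
    (hb.isCompact_closure.cthickening).of_isClosed_subset (isClosed_tsupport _) h1, h1⟩

lemma hNorm_sub_le {v w : Vec → Vec} (hv : ContDiff ℝ ∞ v) (hw : ContDiff ℝ ∞ w) :
    hNorm (v - w) ≤ eLpNorm (v - w) 2 volume +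
      eLpNorm (classicalGrad v - classicalGrad w) 2 volume := by
  refine add_le_add le_rfl ((eLpNorm_fderiv_le_classicalGrad _ _ _).trans_eq ?_)
  congr 1
  ext1 x
  rw [classicalGrad_eq, fderiv_sub (hv.differentiable (by simp) x)
    (hw.differentiable (by simp) x), map_sub]
  rfl

/-- `hNorm` measures derivatives in operator norm; the factor `‖gradOfFDeriv‖` returns to the
Frobenius norm used in X. -/
lemma eLpNorm_classicalGrad_sub_le {v w : Vec → Vec} (hv : ContDiff ℝ ∞ v)
    (hw : ContDiff ℝ ∞ w) :
    eLpNorm (classicalGrad v - classicalGrad w) 2 volume ≤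
      ENNReal.ofReal ‖gradOfFDeriv‖ * hNorm (v - w) := by
  have h1 : ∀ x, ‖(classicalGrad v - classicalGrad w) x‖ ≤
      ‖gradOfFDeriv‖ * ‖fderiv ℝ (v - w) x‖ := by
    intro x
    rw [Pi.sub_apply, classicalGrad_eq, classicalGrad_eq, ← map_sub,
      ← fderiv_sub (hv.differentiable (by simp) x) (hw.differentiable (by simp) x)]
    exact ContinuousLinearMap.le_opNorm _ _
  refine (eLpNorm_le_mul_eLpNorm_of_ae_le_mul (Eventually.of_forall h1) 2).trans ?_
  gcongr
  exact le_add_self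

lemma X.norm_sub_ofTest_le (hΩ : MeasurableSet Ω) (V : X Ω) {ζ : Vec → Vec}
    (hζ : IsSolenoidalTest Ω ζ) {a b : ℝ} (ha : 0 ≤ a) (hb : 0 ≤ b)
    (h1 : eLpNorm (ζ - V.ext) 2 volume ≤ ENNReal.ofReal a)
    (h2 : eLpNorm (classicalGrad ζ - V.extGrad) 2 volume ≤ ENNReal.ofReal b) :
    ‖V - X.ofTest hζ‖ ≤ a + b := by
  have key : ∀ {F : Type} [NormedAddCommGroup F] (f : Lp F 2 (volume.restrict Ω)) {g : Vec → F}
      (hg : MemLp g 2 (volume.restrict Ω)) {c : ℝ}, 0 ≤ c →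
      eLpNorm (g - Ω.indicator f) 2 volume ≤ ENNReal.ofReal c → ‖f - hg.toLp g‖ ≤ c := by
    intro F _ f g hg c hc h
    rw [norm_sub_rev, Lp.norm_def]
    refine ENNReal.toReal_le_of_le_ofReal hc (le_trans ?_ h)
    refine le_trans (le_of_eq (eLpNorm_congr_ae ?_))
      (eLpNorm_mono_measure (g - Ω.indicator f) Measure.restrict_le_self)
    filter_upwards [Lp.coeFn_sub (hg.toLp g) f, hg.coeFn_toLp, ae_restrict_mem hΩ] with x e1 e2 e3
    rw [e1, Pi.sub_apply, Pi.sub_apply, e2, Set.indicator_of_mem e3]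
  refine (X.norm_le _).trans ?_
  rw [add_comm a b]
  exact add_le_add (key V.grad (hζ.test.classicalGrad.memLp 2 (volume.restrict Ω)) hb h2)
    (key V.val (hζ.test.memLp 2 (volume.restrict Ω)) ha h1)

/-- Solenoidal test fields are dense in `X`. -/
lemma X.exists_norm_sub_ofTest_lt (hΩ : IsBoundedLipschitzDomain Ω) (V : X Ω) {ε : ℝ}
    (hε : 0 < ε) : ∃ (ζ : Vec → Vec) (hζ : IsSolenoidalTest Ω ζ), ‖V - X.ofTest hζ‖ < ε := by
  have hm : MeasurableSet Ω := hΩ.isOpen.measurableSet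
  obtain ⟨L, hL⟩ := Shear.exists_list_expels hΩ.boundary_lipschitz hΩ.bounded
  obtain ⟨C, hC⟩ := Shear.hNorm_pullList_le L
  obtain ⟨A, hA⟩ := Shear.antilipschitz_mapList L
  let c : ℝ := ‖gradOfFDeriv‖
  have hc : 0 ≤ c := norm_nonneg gradOfFDeriv
  -- Both mollifications are `δ`-close to `V` in value and in gradient, so `4 * δ` bounds their
  -- mutual `hNorm` distance. `C` is the bound of the Piola transforms; the remaining `δ`s are the
  -- error of the transform on `w₀` and the distance from `w₀` to `V`.
  obtain ⟨δ, hδ, hδε⟩ : ∃ δ : ℝ, 0 < δ ∧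
      (C * (4 * δ) + δ + δ) + (c * (C * (4 * δ) + δ) + δ) < ε := by
    have h1 : Tendsto (fun δ : ℝ => (C * (4 * δ) + δ + δ) + (c * (C * (4 * δ) + δ) + δ))
        (𝓝[>] 0) (𝓝 0) := by
      have : Continuous fun δ : ℝ => (C * (4 * δ) + δ + δ) + (c * (C * (4 * δ) + δ) + δ) := by
        fun_prop
      have h2 := this.tendsto 0
      simp only [mul_zero, add_zero] at h2
      exact tendsto_nhdsWithin_of_tendsto_nhds h2
    obtain ⟨δ, h2, h3⟩ := ((h1.eventually (gt_mem_nhds hε)).and self_mem_nhdsWithin).exists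
    exact ⟨δ, h3, h2⟩
  obtain ⟨r₁, hr₁, hmoll₁⟩ := exists_eLpNorm_moll_sub_le (V.memLp_ext hm) hδ
  obtain ⟨r₂, hr₂, hmoll₂⟩ := exists_eLpNorm_moll_sub_le (V.memLp_extGrad hm) hδ
  have hbump : ∀ r : ℝ, 0 < r → ∃ ρ : ContDiffBump (0 : Vec), ρ.rOut = r := fun r hr =>
    ⟨⟨r / 2, r, by positivity, by linarith⟩, rfl⟩
  -- Two mollifications avoid a circular choice. The reference field `w₀` determines `t`, as the
  -- transforms converge on a fixed test field; the radius of `w` is chosen afterwards and may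
  -- depend on `t`.
  obtain ⟨ρ₀, hρ₀⟩ := hbump (min r₁ r₂) (lt_min hr₁ hr₂)
  let w₀ := moll ρ₀ V.ext
  have hw₀ : IsTest Set.univ w₀ := (V.isTest_moll hm hΩ.bounded ρ₀).mono (Set.subset_univ _)
  have hlim := Shear.tendsto_hNorm_pullList_sub hw₀ L
  have hev : ∀ᶠ t in 𝓝[>] (0 : ℝ),
      hNorm (Shear.pullList L t w₀ - w₀) ≤ ENNReal.ofReal δ :=
    (hlim.eventually (gt_mem_nhds (ENNReal.ofReal_pos.2 hδ))).mono fun _ h => h.le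
  obtain ⟨t, htL, htC, htA, htw⟩ := (hL.and (hC.and (hA.and hev))).exists
  have huc := Shear.uniformContinuous_mapList t L
  -- The image of the complement is closed and misses the compact closure of `Ω`, hence misses a
  -- thickening of it. A field supported in that thickening has its pull-back supported in `Ω`.
  have hclosed : IsClosed (Shear.mapList L t '' Ωᶜ) :=
    (htA.isClosedEmbedding huc).isClosedMap _ hΩ.isOpen.isClosed_compl
  obtain ⟨r₃, hr₃, hthick⟩ := hΩ.bounded.isCompact_closure.exists_cthickening_subset_open
    hclosed.isOpen_compl (fun y hy ⟨x, hx, hxy⟩ => htL x hx (hxy ▸ hy))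
  obtain ⟨ρ, hρ⟩ := hbump (min (min r₁ r₂) r₃) (lt_min (lt_min hr₁ hr₂) hr₃)
  let w := moll ρ V.ext
  have hw := V.isTest_moll hm hΩ.bounded ρ
  have hsub : tsupport (Shear.pullList L t w) ⊆ Shear.mapList L t ⁻¹' tsupport w := by
    refine closure_minimal (fun x hx => ?_) ((isClosed_tsupport w).preimage huc.continuous)
    by_contra h
    exact hx (Shear.pullList_eq_zero t L (image_eq_zero_of_notMem_tsupport h))
  have hsupp : tsupport (Shear.pullList L t w) ⊆ Ω := by
    intro x hx
    by_contra hxΩ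
    refine hthick ?_ ⟨x, hxΩ, rfl⟩
    exact Metric.cthickening_mono (hρ.trans_le (min_le_right _ _)) _ (hw.support (hsub hx))
  have hζ : IsSolenoidalTest Ω (Shear.pullList L t w) :=
    ⟨⟨Shear.contDiff_pullList t hw.smooth L, hΩ.bounded.isCompact_closure.of_isClosed_subset
      (isClosed_tsupport _) (hsupp.trans subset_closure), hsupp⟩,
      Shear.div_pullList t hw.smooth (V.div_moll hm ρ) L⟩
  refine ⟨_, hζ, lt_of_le_of_lt (V.norm_sub_ofTest_le hm hζ ?_ ?_ ?_ ?_) hδε⟩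
  · positivity
  · positivity
  all_goals
    have hρ₁ : ρ.rOut ≤ min r₁ r₂ := hρ.trans_le (min_le_left _ _)
    have hgrad : ∀ ρ : ContDiffBump (0 : Vec),
        classicalGrad (moll ρ V.ext) = moll ρ V.extGrad := fun ρ =>
      funext (V.classicalGrad_moll hm ρ)
    have meas₁ : AEStronglyMeasurable V.ext volume := (V.memLp_ext hm).1
    have meas₂ : AEStronglyMeasurable V.extGrad volume := (V.memLp_extGrad hm).1
    have hw' : AEStronglyMeasurable w volume := hw.smooth.continuous.aestronglyMeasurable
    have hw₀' : AEStronglyMeasurable w₀ volume := hw₀.smooth.continuous.aestronglyMeasurable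
    have hDw' : AEStronglyMeasurable (classicalGrad w) volume :=
      hw.classicalGrad.smooth.continuous.aestronglyMeasurable
    have hDw₀' : AEStronglyMeasurable (classicalGrad w₀) volume :=
      hw₀.classicalGrad.smooth.continuous.aestronglyMeasurable
    have e1 : eLpNorm (w - V.ext) 2 volume ≤ ENNReal.ofReal δ :=
      hmoll₁ ρ (hρ₁.trans (min_le_left _ _))
    have e2 : eLpNorm (w₀ - V.ext) 2 volume ≤ ENNReal.ofReal δ :=
      hmoll₁ ρ₀ (hρ₀.trans_le (min_le_left _ _))
    have e3 : eLpNorm (classicalGrad w - V.extGrad) 2 volume ≤ ENNReal.ofReal δ := by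
      rw [hgrad]; exact hmoll₂ ρ (hρ₁.trans (min_le_right _ _))
    have e4 : eLpNorm (classicalGrad w₀ - V.extGrad) 2 volume ≤ ENNReal.ofReal δ := by
      rw [hgrad]; exact hmoll₂ ρ₀ (hρ₀.trans_le (min_le_right _ _))
    have e5 : hNorm (w - w₀) ≤ ENNReal.ofReal (4 * δ) := by
      have f1 : w - w₀ = (w - V.ext) - (w₀ - V.ext) := by abel
      have f2 : classicalGrad w - classicalGrad w₀ =
          (classicalGrad w - V.extGrad) - (classicalGrad w₀ - V.extGrad) := by abel
      have f3 : eLpNorm (w - w₀) 2 volume ≤ ENNReal.ofReal δ + ENNReal.ofReal δ := by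
        rw [f1]
        exact (eLpNorm_sub_le (hw'.sub meas₁) (hw₀'.sub meas₁) (by norm_num)).trans
          (add_le_add e1 e2)
      have f4 : eLpNorm (classicalGrad w - classicalGrad w₀) 2 volume ≤
          ENNReal.ofReal δ + ENNReal.ofReal δ := by
        rw [f2]
        exact (eLpNorm_sub_le (hDw'.sub meas₂) (hDw₀'.sub meas₂) (by norm_num)).trans
          (add_le_add e3 e4)
      refine (hNorm_sub_le hw.smooth hw₀.smooth).trans ((add_le_add f3 f4).trans_eq ?_)
      rw [← ENNReal.ofReal_add hδ.le hδ.le, ← ENNReal.ofReal_add (by positivity) (by positivity)]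
      congr 1
      ring
    have e6 : hNorm (Shear.pullList L t w - w₀) ≤ ENNReal.ofReal (C * (4 * δ) + δ) := by
      have f1 : Shear.pullList L t w - w₀ =
          Shear.pullList L t (w - w₀) + (Shear.pullList L t w₀ - w₀) := by
        rw [Shear.pullList_sub]; abel
      have f2 : ContDiff ℝ ∞ (w - w₀) := hw.smooth.sub hw₀.smooth
      have f3 : ContDiff ℝ ∞ (Shear.pullList L t w₀ - w₀) :=
        (Shear.contDiff_pullList t hw₀.smooth L).sub hw₀.smooth
      rw [f1, ENNReal.ofReal_add (by positivity) hδ.le, ENNReal.ofReal_mul (by positivity),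
        ENNReal.ofReal_coe_nnreal]
      refine (hNorm_add_le (Shear.contDiff_pullList t f2 L) f3).trans (add_le_add ?_ htw)
      exact (htC _ f2).trans (by gcongr)
  · have f1 : Shear.pullList L t w - V.ext = (Shear.pullList L t w - w₀) + (w₀ - V.ext) := by abel
    rw [f1, ENNReal.ofReal_add (by positivity) hδ.le]
    refine (eLpNorm_add_le (hζ.test.smooth.continuous.aestronglyMeasurable.sub hw₀')
      (hw₀'.sub meas₁) (by norm_num)).trans (add_le_add (le_trans ?_ e6) e2)
    exact le_self_add
  · have f1 : classicalGrad (Shear.pullList L t w) - V.extGrad =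
        (classicalGrad (Shear.pullList L t w) - classicalGrad w₀) +
          (classicalGrad w₀ - V.extGrad) := by abel
    rw [f1, ENNReal.ofReal_add (by positivity) hδ.le, ENNReal.ofReal_mul hc]
    refine (eLpNorm_add_le
      (hζ.test.classicalGrad.smooth.continuous.aestronglyMeasurable.sub hDw₀')
      (hDw₀'.sub meas₂) (by norm_num)).trans (add_le_add ?_ e4)
    exact (eLpNorm_classicalGrad_sub_le hζ.test.smooth hw₀.smooth).trans (by gcongr)

end

/-! ### Exponents -/

lemma ennreal_eq_of_toReal {a b : ℝ≥0∞} (ha : a ≠ ⊤) (hb : b ≠ ⊤) (h : a.toReal = b.toReal) :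
    a = b := (ENNReal.toReal_eq_toReal_iff' ha hb).1 h

/-- Used for (a·∇)V with a ∈ L⁶ and ∇V ∈ L², and for the inclusion of L² in L^{3/2} as
multiplication by 1 ∈ L⁶. -/
instance : ENNReal.HolderTriple 6 2 (3 / 2) := ⟨by
  refine ennreal_eq_of_toReal (by finiteness) (by simp) ?_
  rw [ENNReal.toReal_add (by simp) (by simp)]
  simp only [ENNReal.toReal_inv, ENNReal.toReal_div, ENNReal.toReal_ofNat]
  norm_num⟩

/-- Gives the inclusion of L⁶ in L³, again as multiplication by 1 ∈ L⁶. -/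
instance : ENNReal.HolderTriple 6 6 3 := ⟨by
  refine ennreal_eq_of_toReal (by finiteness) (by simp) ?_
  rw [ENNReal.toReal_add (by simp) (by simp)]
  simp only [ENNReal.toReal_inv, ENNReal.toReal_ofNat]
  norm_num⟩

instance : ENNReal.HolderConjugate (3 / 2) 3 := ⟨by
  refine ennreal_eq_of_toReal (by simp) (by simp) ?_
  rw [ENNReal.toReal_add (by simp) (by simp)]
  simp only [ENNReal.toReal_inv, ENNReal.toReal_div, ENNReal.toReal_ofNat]
  norm_num⟩

lemma one_le_three_halves : (1 : ℝ≥0∞) ≤ 3 / 2 := by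
  rw [ENNReal.le_div_iff_mul_le (by simp) (by simp)]
  norm_num

lemma three_halves_le_six : (3 / 2 : ℝ≥0∞) ≤ 6 := by
  refine ENNReal.div_le_of_le_mul ?_
  norm_num

instance : Fact ((1 : ℝ≥0∞) ≤ 3 / 2) := ⟨one_le_three_halves⟩
instance : Fact ((1 : ℝ≥0∞) ≤ 6) := ⟨by norm_num⟩
instance : Fact ((1 : ℝ≥0∞) ≤ 3) := ⟨by norm_num⟩

/-- Interpolation of `L³` between `L²` and `L⁶`. -/
lemma eLpNorm_three_sq_le {α F : Type*} [MeasurableSpace α] [NormedAddCommGroup F] {μ : Measure α}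
    {f : α → F} (hf : AEStronglyMeasurable f μ) :
    eLpNorm f 3 μ ^ (2 : ℝ) ≤ eLpNorm f 2 μ * eLpNorm f 6 μ := by
  -- Hölder for |f|³ = (|f|²)^{3/4} (|f|⁶)^{1/4}; raising the result to the power 2/3 gives exactly
  -- the exponents 1/2 and 1/6 of the two norms.
  have h1 := ENNReal.lintegral_mul_norm_pow_le (μ := μ) (f := fun x => ‖f x‖ₑ ^ (2 : ℝ))
    (g := fun x => ‖f x‖ₑ ^ (6 : ℝ)) (hf.enorm.pow_const _) (hf.enorm.pow_const _)
    (p := 3 / 4) (q := 1 / 4) (by norm_num) (by norm_num) (by norm_num)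
  have h2 : ∀ x, (‖f x‖ₑ ^ (2 : ℝ)) ^ (3 / 4 : ℝ) * (‖f x‖ₑ ^ (6 : ℝ)) ^ (1 / 4 : ℝ) =
      ‖f x‖ₑ ^ (3 : ℝ) := by
    intro x
    rw [← ENNReal.rpow_mul, ← ENNReal.rpow_mul,
      ← ENNReal.rpow_add_of_nonneg _ _ (by norm_num) (by norm_num)]
    norm_num
  simp only [h2] at h1
  have key : ∀ p : ℝ≥0∞, p ≠ 0 → p ≠ ⊤ →
      eLpNorm f p μ = (∫⁻ x, ‖f x‖ₑ ^ p.toReal ∂μ) ^ (1 / p.toReal) := fun p h0 ht =>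
    eLpNorm_eq_lintegral_rpow_enorm_toReal h0 ht
  rw [key 3 (by simp) (by simp), key 2 (by simp) (by simp), key 6 (by simp) (by simp)]
  simp only [ENNReal.toReal_ofNat]
  have h3 := ENNReal.rpow_le_rpow h1 (by norm_num : (0 : ℝ) ≤ 2 / 3)
  rw [ENNReal.mul_rpow_of_nonneg _ _ (by norm_num), ← ENNReal.rpow_mul, ← ENNReal.rpow_mul] at h3
  rw [← ENNReal.rpow_mul]
  norm_num at h3 ⊢
  exact h3

/-- A criterion for total boundedness. -/
lemma totallyBounded_of_exists_map {α : Type} [PseudoMetricSpace α] {s : Set α}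
    (h : ∀ ε > 0, ∃ (ι : Type) (_ : Fintype ι) (f : α → ι → Vec), Bornology.IsBounded (f '' s) ∧
      ∃ δ > 0, ∀ x ∈ s, ∀ y ∈ s, dist (f x) (f y) < δ → dist x y < ε) : TotallyBounded s := by
  refine Metric.totallyBounded_of_finite_discretization fun ε hε => ?_
  obtain ⟨ι, _, f, hb, δ, hδ, hf⟩ := h ε hε
  obtain ⟨t, htf, ht⟩ := Metric.totallyBounded_iff.1
    (hb.isCompact_closure.totallyBounded.subset subset_closure) (δ / 2) (by positivity)
  have hF : ∀ x : s, ∃ y : t, dist (f x) y.1 < δ / 2 := by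
    intro x
    obtain ⟨y, hy, hxy⟩ := Set.mem_iUnion₂.1 (ht (Set.mem_image_of_mem f x.2))
    exact ⟨⟨y, hy⟩, hxy⟩
  choose F hF using hF
  refine ⟨t, htf.fintype, F, fun x y hxy => hf _ x.2 _ y.2 ?_⟩
  have h1 := hF x
  have h2 := hF y
  rw [← hxy] at h2
  linarith [dist_triangle_right (f x) (f y) (F x).1]

section

variable {Ω : Set Vec}

/-! ### The operators on `X` -/

/-- Poincaré's inequality on `X`. -/
lemma X.exists_norm_sq_le (hΩ : MeasurableSet Ω) (hb : Bornology.IsBounded Ω) :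
    ∃ C : ℝ, 0 < C ∧ ∀ V : X Ω, ‖V‖ ^ 2 ≤ C * ‖V.grad‖ ^ 2 := by
  obtain ⟨C, hC⟩ := exists_poincare_H10 hΩ hb
  refine ⟨1 + C ^ 2, by positivity, fun V => ?_⟩
  have h1 : ‖V.val‖ ≤ C * ‖V.grad‖ := hC V.1 V.2.1
  have h2 := pow_le_pow_left₀ (norm_nonneg _) h1 2
  rw [V.norm_sq]
  nlinarith [sq_nonneg ‖V.val‖]

/-- The Dirichlet form. -/
def X.dirichlet (Ω : Set Vec) : X Ω →L[ℝ] X Ω →L[ℝ] ℝ :=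
  (innerSL ℝ).bilinearComp (X.gradL Ω) (X.gradL Ω)

lemma X.dirichlet_apply (V W : X Ω) : X.dirichlet Ω V W = inner ℝ V.grad W.grad := rfl

/-- The weak Stokes problem is uniquely solvable for functionals on `X`. -/
lemma X.exists_stokes_solver (hΩ : MeasurableSet Ω) (hb : Bornology.IsBounded Ω) :
    ∃ T : (X Ω →L[ℝ] ℝ) → X Ω, Continuous T ∧ (∀ ℓ, X.dirichlet Ω (T ℓ) = ℓ) ∧
      (∀ W, T (X.dirichlet Ω W) = W) ∧ ∃ C : ℝ, 0 ≤ C ∧ ∀ ℓ, ‖T ℓ‖ ≤ C * ‖ℓ‖ := by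
  obtain ⟨C, hC0, hC⟩ := X.exists_norm_sq_le hΩ hb
  -- Coercivity is Poincaré's inequality. The Lax–Milgram operator composed with the Riesz
  -- isomorphism is then the Dirichlet form itself.
  have hco : IsCoercive (X.dirichlet Ω) := by
    refine ⟨C⁻¹, by positivity, fun V => ?_⟩
    rw [X.dirichlet_apply, real_inner_self_eq_norm_sq, mul_assoc, ← sq, inv_mul_le_iff₀ hC0]
    exact hC V
  let A := hco.continuousLinearEquivOfBilin
  let D := InnerProductSpace.toDual ℝ (X Ω)
  have hA : ∀ V, D (A V) = X.dirichlet Ω V := fun V => by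
    ext W
    rw [InnerProductSpace.toDual_apply_apply]
    exact hco.continuousLinearEquivOfBilin_apply V W
  refine ⟨fun ℓ => A.symm (D.symm ℓ), A.symm.continuous.comp D.symm.continuous, fun ℓ => ?_,
    fun W => ?_, ‖(A.symm : X Ω →L[ℝ] X Ω)‖, norm_nonneg _, fun ℓ => ?_⟩
  · rw [← hA]; simp
  · rw [← hA]; simp
  · rw [← D.symm.norm_map ℓ]
    exact (A.symm : X Ω →L[ℝ] X Ω).le_opNorm _

/-- The Sobolev embedding of `X`. -/
lemma X.exists_sobolev_embedding (hΩ : MeasurableSet Ω) :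
    ∃ J : X Ω →L[ℝ] Lp Vec 6 (volume.restrict Ω), ∀ V, J V =ᵐ[volume.restrict Ω] V.val := by
  obtain ⟨C, hC⟩ := exists_sobolev_H10 hΩ
  have hle : ∀ V : X Ω, eLpNorm V.val 6 (volume.restrict Ω) ≤ C * ‖V.grad‖ₑ :=
    fun V => hC V.1 V.2.1
  have hmem : ∀ V : X Ω, MemLp V.val 6 (volume.restrict Ω) := fun V =>
    ⟨Lp.aestronglyMeasurable _, (hle V).trans_lt (ENNReal.mul_lt_top (by simp) enorm_lt_top)⟩
  let J₀ : X Ω →ₗ[ℝ] Lp Vec 6 (volume.restrict Ω) :=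
    { toFun := fun V => (hmem V).toLp
      map_add' := fun V W => by
        rw [← MemLp.toLp_add]
        exact MemLp.toLp_congr _ _ (Lp.coeFn_add _ _)
      map_smul' := fun c V => by
        rw [RingHom.id_apply, ← MemLp.toLp_const_smul]
        exact MemLp.toLp_congr _ _ (Lp.coeFn_smul _ _) }
  refine ⟨J₀.mkContinuous C fun V => ?_, fun V => (hmem V).coeFn_toLp⟩
  change ‖(hmem V).toLp‖ ≤ _
  rw [Lp.norm_toLp]
  have h1 := ENNReal.toReal_mono (ENNReal.mul_ne_top (by simp) enorm_ne_top) (hle V)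
  rw [ENNReal.toReal_mul, toReal_enorm, ENNReal.coe_toReal] at h1
  exact h1.trans (by gcongr; exact V.norm_grad_le)

/-! ### Right-hand sides in L^{3/2} and their action on X. -/

variable [IsFiniteMeasure (volume.restrict Ω)]

/-- The constant function `1`. -/
def oneL6 (Ω : Set Vec) [IsFiniteMeasure (volume.restrict Ω)] : Lp ℝ 6 (volume.restrict Ω) :=
  (memLp_const (1 : ℝ)).toLp

lemma oneL6_ae : oneL6 Ω =ᵐ[volume.restrict Ω] fun _ => (1 : ℝ) := MemLp.coeFn_toLp _

/-- The inclusion of `L⁶` in `L³`. -/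
def inclL3 (Ω : Set Vec) [IsFiniteMeasure (volume.restrict Ω)] :
    Lp Vec 6 (volume.restrict Ω) →L[ℝ] Lp Vec 3 (volume.restrict Ω) :=
  (ContinuousLinearMap.lsmul ℝ ℝ : ℝ →L[ℝ] Vec →L[ℝ] Vec).holderL (volume.restrict Ω) 6 6 3 (oneL6 Ω)

lemma inclL3_ae (f : Lp Vec 6 (volume.restrict Ω)) : inclL3 Ω f =ᵐ[volume.restrict Ω] f := by
  filter_upwards [ContinuousLinearMap.coeFn_holder (r := 3)
    (ContinuousLinearMap.lsmul ℝ ℝ : ℝ →L[ℝ] Vec →L[ℝ] Vec) (oneL6 Ω) f, oneL6_ae (Ω := Ω)]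
    with x h1 h2
  refine h1.trans ?_
  rw [h2]
  simp

/-- The inclusion of `L²` in `L^{3/2}`. -/
def inclL32 (Ω : Set Vec) [IsFiniteMeasure (volume.restrict Ω)] :
    Lp Vec 2 (volume.restrict Ω) →L[ℝ] Lp Vec (3 / 2) (volume.restrict Ω) :=
  (ContinuousLinearMap.lsmul ℝ ℝ : ℝ →L[ℝ] Vec →L[ℝ] Vec).holderL (volume.restrict Ω) 6 2 (3 / 2)
    (oneL6 Ω)

lemma inclL32_ae (f : Lp Vec 2 (volume.restrict Ω)) : inclL32 Ω f =ᵐ[volume.restrict Ω] f := by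
  filter_upwards [ContinuousLinearMap.coeFn_holder (r := 3 / 2)
    (ContinuousLinearMap.lsmul ℝ ℝ : ℝ →L[ℝ] Vec →L[ℝ] Vec) (oneL6 Ω) f, oneL6_ae (Ω := Ω)]
    with x h1 h2
  refine h1.trans ?_
  rw [h2]
  simp

omit [IsFiniteMeasure (volume.restrict Ω)] in
/-- The product `(a · ∇) f` as a bounded bilinear map `L⁶ × L² → L^{3/2}`. -/
def convectLp (Ω : Set Vec) : Lp Vec 6 (volume.restrict Ω) →L[ℝ] Lp Grad 2 (volume.restrict Ω) →L[ℝ]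
    Lp Vec (3 / 2) (volume.restrict Ω) :=
  convectL.holderL (volume.restrict Ω) 6 2 (3 / 2)

omit [IsFiniteMeasure (volume.restrict Ω)] in
lemma convectLp_ae (a : Lp Vec 6 (volume.restrict Ω)) (A : Lp Grad 2 (volume.restrict Ω)) :
    convectLp Ω a A =ᵐ[volume.restrict Ω] fun x => convect (a x) (A x) :=
  ContinuousLinearMap.coeFn_holder (r := 3 / 2) convectL a A

/-- Functions in `L^{3/2}` as functionals on `X`, through the embedding `J`. -/
def X.functional (J : X Ω →L[ℝ] Lp Vec 6 (volume.restrict Ω)) :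
    Lp Vec (3 / 2) (volume.restrict Ω) →L[ℝ] X Ω →L[ℝ] ℝ :=
  (ContinuousLinearMap.compL ℝ (X Ω) (Lp Vec 3 (volume.restrict Ω)) ℝ).flip (inclL3 Ω ∘L J) ∘L
    (innerSL ℝ : Vec →L[ℝ] Vec →L[ℝ] ℝ).lpPairing (volume.restrict Ω) (3 / 2) 3

lemma X.functional_apply {J : X Ω →L[ℝ] Lp Vec 6 (volume.restrict Ω)}
    (hJ : ∀ V, J V =ᵐ[volume.restrict Ω] V.val) (g : Lp Vec (3 / 2) (volume.restrict Ω))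
    (V : X Ω) : X.functional J g V = ∫ x in Ω, inner ℝ (g x) (V.val x) := by
  refine (ContinuousLinearMap.lpPairing_eq_integral _ _ _).trans (integral_congr_ae ?_)
  filter_upwards [inclL3_ae (J V), hJ V] with x h1 h2
  change inner ℝ (g x) (inclL3 Ω (J V) x) = _
  rw [h1, h2]

/-- Hölder between L^{3/2} and L³, then interpolation of L³ and the Sobolev bound. The gain is the
factor `‖V.val‖`, an L² norm, on which Rellich's theorem acts. -/
lemma X.exists_functional_self_le {J : X Ω →L[ℝ] Lp Vec 6 (volume.restrict Ω)}
    (hJ : ∀ V, J V =ᵐ[volume.restrict Ω] V.val) : ∃ C : ℝ, 0 ≤ C ∧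
      ∀ (g : Lp Vec (3 / 2) (volume.restrict Ω)) (V : X Ω),
        X.functional J g V ^ 2 ≤ C * ‖g‖ ^ 2 * (‖V.val‖ * ‖V‖) := by
  let Λ := (innerSL ℝ : Vec →L[ℝ] Vec →L[ℝ] ℝ).lpPairing (volume.restrict Ω) (3 / 2) 3
  refine ⟨‖Λ‖ ^ 2 * ‖J‖, by positivity, fun g V => ?_⟩
  have h1 : |X.functional J g V| ≤ ‖Λ‖ * ‖g‖ * ‖inclL3 Ω (J V)‖ := Λ.le_opNorm₂ _ _
  have h2 : ‖inclL3 Ω (J V)‖ ^ 2 ≤ ‖V.val‖ * ‖J V‖ := by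
    have h3 := eLpNorm_three_sq_le (Lp.aestronglyMeasurable V.val)
    have h4 := ENNReal.toReal_mono (ENNReal.mul_ne_top (Lp.eLpNorm_ne_top _)
      (by rw [← eLpNorm_congr_ae (hJ V)]; exact Lp.eLpNorm_ne_top _)) h3
    rw [ENNReal.toReal_mul, ← ENNReal.toReal_rpow,
      ← eLpNorm_congr_ae ((inclL3_ae (J V)).trans (hJ V)), ← eLpNorm_congr_ae (p := 6) (hJ V),
      ← Lp.norm_def, ← Lp.norm_def] at h4
    exact_mod_cast h4
  calc X.functional J g V ^ 2 = |X.functional J g V| ^ 2 := (sq_abs _).symm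
    _ ≤ (‖Λ‖ * ‖g‖ * ‖inclL3 Ω (J V)‖) ^ 2 := by gcongr
    _ = (‖Λ‖ * ‖g‖) ^ 2 * ‖inclL3 Ω (J V)‖ ^ 2 := by ring
    _ ≤ (‖Λ‖ * ‖g‖) ^ 2 * (‖V.val‖ * (‖J‖ * ‖V‖)) := by
      gcongr
      exact h2.trans (by gcongr; exact J.le_opNorm V)
    _ = _ := by ring

lemma X.exists_norm_functional_le (J : X Ω →L[ℝ] Lp Vec 6 (volume.restrict Ω)) :
    ∃ C : ℝ, 0 ≤ C ∧ ∀ g, ‖X.functional J g‖ ≤ C * ‖g‖ := by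
  let Λ := (innerSL ℝ : Vec →L[ℝ] Vec →L[ℝ] ℝ).lpPairing (volume.restrict Ω) (3 / 2) 3
  refine ⟨‖Λ‖ * ‖inclL3 Ω ∘L J‖, by positivity, fun g => ?_⟩
  refine ContinuousLinearMap.opNorm_le_bound _ (by positivity) fun V => ?_
  calc ‖X.functional J g V‖ ≤ ‖Λ‖ * ‖g‖ * ‖(inclL3 Ω ∘L J) V‖ := Λ.le_opNorm₂ _ _
    _ ≤ ‖Λ‖ * ‖g‖ * (‖inclL3 Ω ∘L J‖ * ‖V‖) := by
      gcongr
      exact (inclL3 Ω ∘L J).le_opNorm V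
    _ = _ := by ring

/-- The set of Stokes solutions with right-hand sides in a bounded subset of `L^{3/2}` is totally
bounded. -/
lemma X.totallyBounded_of_dirichlet_eq (hΩ : MeasurableSet Ω) (hb : Bornology.IsBounded Ω)
    {J : X Ω →L[ℝ] Lp Vec 6 (volume.restrict Ω)}
    (hJ : ∀ V, J V =ᵐ[volume.restrict Ω] V.val) {ℓ : X Ω →L[ℝ] ℝ} {s : Set (X Ω)} {M : ℝ}
    (hsb : Bornology.IsBounded s)
    (hs : ∀ V ∈ s, ∃ g : Lp Vec (3 / 2) (volume.restrict Ω), ‖g‖ ≤ M ∧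
      X.dirichlet Ω V = X.functional J g + ℓ) : TotallyBounded s := by
  obtain ⟨C, hC0, hC⟩ := X.exists_norm_sq_le hΩ hb
  obtain ⟨K, hK0, hK⟩ := X.exists_functional_self_le hJ
  obtain ⟨R, hR0, hR⟩ : ∃ R : ℝ, 0 < R ∧ ∀ u ∈ s, ‖u‖ ≤ R := hsb.exists_pos_norm_le
  -- Test the difference of the two equations with `u - v`; the common functional `ℓ` cancels. The
  -- fourth power comes from squaring the energy identity to use the squared bound on the
  -- functional.
  have energy : ∀ u ∈ s, ∀ v ∈ s,
      ‖u - v‖ ^ 4 ≤ C ^ 2 * (K * (2 * M) ^ 2 * (2 * R)) * ‖(u - v).val‖ := by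
    intro u hu v hv
    obtain ⟨g, hg, hgu⟩ := hs u hu
    obtain ⟨g', hg', hgv⟩ := hs v hv
    have h1 : ‖(u - v).grad‖ ^ 2 = X.functional J (g - g') (u - v) := by
      rw [← real_inner_self_eq_norm_sq, ← X.dirichlet_apply, map_sub (X.dirichlet Ω), hgu, hgv,
        map_sub (X.functional J)]
      simp
    have h2 : ‖u - v‖ ≤ 2 * R := by
      linarith [norm_sub_le u v, hR u hu, hR v hv]
    have h3 : ‖g - g'‖ ≤ 2 * M := by linarith [norm_sub_le g g']
    calc ‖u - v‖ ^ 4 = (‖u - v‖ ^ 2) ^ 2 := by ring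
      _ ≤ (C * ‖(u - v).grad‖ ^ 2) ^ 2 := by gcongr; exact hC _
      _ = C ^ 2 * X.functional J (g - g') (u - v) ^ 2 := by rw [h1]; ring
      _ ≤ C ^ 2 * (K * ‖g - g'‖ ^ 2 * (‖(u - v).val‖ * ‖u - v‖)) := by gcongr; exact hK _ _
      _ ≤ C ^ 2 * (K * (2 * M) ^ 2 * (‖(u - v).val‖ * (2 * R))) := by gcongr
      _ = _ := by ring
  set B := C ^ 2 * (K * (2 * M) ^ 2 * (2 * R)) with hB
  have hB0 : 0 ≤ B := by positivity
  refine totallyBounded_of_exists_map fun ε hε => ?_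
  obtain ⟨δ, hδ, hδε⟩ : ∃ δ : ℝ, 0 < δ ∧ B * δ < ε ^ 4 := by
    refine ⟨ε ^ 4 / (B + 1), by positivity, ?_⟩
    rw [mul_div_assoc', div_lt_iff₀ (by positivity), mul_comm]
    have : 0 < ε ^ 4 := by positivity
    nlinarith
  -- The L² norms of `u - v` and its gradient add up to at most `6 * R`, so this term contributes at
  -- most `δ / 2`; the finite-dimensional map supplies the other half.
  obtain ⟨ι, _, G, hG⟩ := exists_rellich hΩ hb (ε := δ / (12 * R)) (by positivity)
  refine ⟨ι, inferInstance, fun V => G V.val, ?_, δ / 2, by positivity, fun u hu v hv huv => ?_⟩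
  · exact (G ∘L X.valL Ω).lipschitz.isBounded_image hsb
  · rw [dist_eq_norm] at huv ⊢
    have h1 : G u.val - G v.val = G (u - v).val := by rw [← map_sub]; rfl
    rw [h1] at huv
    have h2 : ‖(u - v).val‖ ≤ δ / (12 * R) * (‖(u - v).val‖ + ‖(u - v).grad‖) + ‖G (u - v).val‖ :=
      hG (u - v).1 (u - v).2.1
    have h3 : ‖(u - v).val‖ + ‖(u - v).grad‖ ≤ 6 * R := by
      linarith [(u - v).norm_val_le, (u - v).norm_grad_le, norm_sub_le u v, hR u hu, hR v hv]
    have h4 : ‖(u - v).val‖ ≤ δ := by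
      calc _ ≤ δ / (12 * R) * (6 * R) + δ / 2 := by
            refine h2.trans (add_le_add ?_ huv.le)
            gcongr
        _ = δ := by field_simp; ring
    have h5 : ‖u - v‖ ^ 4 < ε ^ 4 :=
      ((energy u hu v hv).trans (by gcongr)).trans_lt hδε
    exact lt_of_pow_lt_pow_left₀ 4 hε.le h5

end

/-! ### Identification of functionals by test fields, and the nonlinear map V ↦ V + x·∇V + F₁(V). -/

section

variable {Ω : Set Vec}

/-- A continuous functional on `X` vanishing on solenoidal test fields vanishes. -/
lemma X.clm_eq_of_eq_on_tests (hΩ : IsBoundedLipschitzDomain Ω) {ℓ ℓ' : X Ω →L[ℝ] ℝ}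
    (h : ∀ ζ (hζ : IsSolenoidalTest Ω ζ), ℓ (X.ofTest hζ) = ℓ' (X.ofTest hζ)) : ℓ = ℓ' := by
  have hd : Dense {V : X Ω | ∃ ζ, ∃ hζ : IsSolenoidalTest Ω ζ, V = X.ofTest hζ} := by
    intro V
    refine Metric.mem_closure_iff.2 fun ε hε => ?_
    obtain ⟨ζ, hζ, hlt⟩ := V.exists_norm_sub_ofTest_lt hΩ hε
    exact ⟨_, ⟨ζ, hζ, rfl⟩, by rwa [dist_eq_norm]⟩
  refine ContinuousLinearMap.coeFn_injective (Continuous.ext_on hd ℓ.continuous ℓ'.continuous ?_)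
  rintro _ ⟨ζ, hζ, rfl⟩
  exact h ζ hζ

/-- The linear and quadratic terms of `G(V)` as an element of `L^{3/2}`. -/
def nonlinearity [IsFiniteMeasure (volume.restrict Ω)]
    (J : X Ω →L[ℝ] Lp Vec 6 (volume.restrict Ω)) (x₆ U₆ : Lp Vec 6 (volume.restrict Ω))
    (D : Lp Grad 2 (volume.restrict Ω)) (V : X Ω) : Lp Vec (3 / 2) (volume.restrict Ω) :=
  inclL32 Ω V.val + convectLp Ω x₆ V.grad +
    (-convectLp Ω (U₆ + J V) V.grad - convectLp Ω (J V) D)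

section

variable [IsFiniteMeasure (volume.restrict Ω)]
  {J : X Ω →L[ℝ] Lp Vec 6 (volume.restrict Ω)} {x₆ U₆ : Lp Vec 6 (volume.restrict Ω)}
  {D : Lp Grad 2 (volume.restrict Ω)}

/-- Every term is a bounded linear or bilinear expression in V, ∇V and the L⁶ representative `J V`.
-/
lemma continuous_nonlinearity : Continuous (nonlinearity J x₆ U₆ D) := by
  have h1 : Continuous fun V : X Ω => V.val := (X.valL Ω).continuous
  have h2 : Continuous fun V : X Ω => V.grad := (X.gradL Ω).continuous
  unfold nonlinearity
  fun_prop

lemma exists_norm_nonlinearity_le (R : ℝ) : ∃ M, ∀ V : X Ω, ‖V‖ ≤ R →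
    ‖nonlinearity J x₆ U₆ D V‖ ≤ M := by
  refine ⟨‖inclL32 Ω‖ * (2 * R) + ‖convectLp Ω‖ * ‖x₆‖ * R +
    (‖convectLp Ω‖ * (‖U₆‖ + ‖J‖ * R) * R + ‖convectLp Ω‖ * (‖J‖ * R) * ‖D‖), fun V hV => ?_⟩
  have hR : 0 ≤ R := (norm_nonneg _).trans hV
  have hJ : ‖J V‖ ≤ ‖J‖ * R := (J.le_opNorm V).trans (by gcongr)
  have hg : ‖V.grad‖ ≤ R := V.norm_grad_le.trans hV
  have hv : ‖V.val‖ ≤ 2 * R := V.norm_val_le.trans (by gcongr)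
  refine (norm_add_le _ _).trans (add_le_add ((norm_add_le _ _).trans (add_le_add ?_ ?_))
    ((norm_sub_le _ _).trans (add_le_add ?_ ?_)))
  · exact ((inclL32 Ω).le_opNorm _).trans (by gcongr)
  · exact ((convectLp Ω).le_opNorm₂ _ _).trans (by gcongr)
  · rw [norm_neg]
    exact ((convectLp Ω).le_opNorm₂ _ _).trans
      (by gcongr; exact (norm_add_le _ _).trans (by gcongr))
  · exact ((convectLp Ω).le_opNorm₂ _ _).trans (by gcongr)

set_option maxHeartbeats 1000000 in
lemma nonlinearity_ae {U₀ : Vec → Vec} {DU₀ : Vec → Grad}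
    (hJ : ∀ V, J V =ᵐ[volume.restrict Ω] V.val) (hx : x₆ =ᵐ[volume.restrict Ω] id)
    (hU : U₆ =ᵐ[volume.restrict Ω] U₀) (hD : D =ᵐ[volume.restrict Ω] DU₀) (V : X Ω) :
    nonlinearity J x₆ U₆ D V =ᵐ[volume.restrict Ω]
      fun x => V.val x + convect x (V.grad x) + F1 U₀ DU₀ V x := by
  have hsum : ∀ f g h k : Lp Vec (3 / 2) (volume.restrict Ω),
      (f + g + (-h - k) : Lp Vec (3 / 2) (volume.restrict Ω)) =ᵐ[volume.restrict Ω]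
        fun x => f x + g x + (-h x - k x) := by
    intro f g h k
    filter_upwards [Lp.coeFn_add (f + g) (-h - k), Lp.coeFn_add f g, Lp.coeFn_sub (-h) k,
      Lp.coeFn_neg h] with x h1 h2 h3 h4
    rw [h1, Pi.add_apply, h2, h3, Pi.sub_apply, h4, Pi.add_apply, Pi.neg_apply]
  filter_upwards [hJ V, hx, hU, hD, inclL32_ae V.val, convectLp_ae x₆ V.grad,
    convectLp_ae (U₆ + J V) V.grad, convectLp_ae (J V) D, Lp.coeFn_add U₆ (J V),
    hsum (inclL32 Ω V.val) (convectLp Ω x₆ V.grad) (convectLp Ω (U₆ + J V) V.grad)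
      (convectLp Ω (J V) D)] with x h1 h2 h3 h4 h5 h6 h7 h8 h9 h10
  refine h10.trans ?_
  rw [h5, h6, h7, h8, h9, Pi.add_apply, h1, h2, h3, h4]
  rfl

end

end

end Leray

end

/-! ### Assembly of the solution map. -/

theorem mainTheorem7 (Ω : Set Leray.Vec) (hΩ : Leray.IsBoundedLipschitzDomain Ω)
    (U₀ : Leray.Vec → Leray.Vec) (DU₀ : Leray.Vec → Leray.Grad)
    (hU₀ : Leray.BoundaryData Ω U₀ DU₀) :
    ∃ S : Leray.X Ω → Leray.X Ω,
      (∀ V W : Leray.X Ω,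
        Leray.IsStokesSolution Ω (Leray.pairG Ω U₀ DU₀ V) W ↔ W = S V) ∧
      Continuous S ∧
      ∀ B : Set (Leray.X Ω), Bornology.IsBounded B → IsCompact (closure (S '' B)) := by
  open Leray in
  have hm : MeasurableSet Ω := hΩ.isOpen.measurableSet
  set μ := volume.restrict Ω with hμ
  have hfin : IsFiniteMeasure μ :=
    ⟨by rw [hμ, Measure.restrict_apply_univ]; exact hΩ.bounded.measure_lt_top⟩
  obtain ⟨J, hJ⟩ := X.exists_sobolev_embedding hm
  obtain ⟨T, hTc, hT, hT', C, hC0, hC⟩ := X.exists_stokes_solver hm hΩ.bounded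
  obtain ⟨r, hr⟩ := hΩ.bounded.exists_norm_le
  have hxm : MemLp (id : Vec → Vec) 6 μ := MemLp.of_bound continuous_id.aestronglyMeasurable r
    ((ae_restrict_iff' hm).2 (Filter.Eventually.of_forall hr))
  let x₆ := hxm.toLp
  let U₆ := hU₀.memL6.toLp
  let D := hU₀.grad_memL2.toLp
  let U₃ := (hU₀.memL6.mono_exponent three_halves_le_six).toLp
  let N := nonlinearity J x₆ U₆ D
  -- F₀ without its Laplacian lies in L^{3/2}. The term ΔU₀ enters `ℓ₀` as minus the L² pairing of
  -- gradients.
  let f₀ : Lp Vec (3 / 2) μ := U₃ + convectLp Ω x₆ D - convectLp Ω U₆ D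
  let ℓ₀ : X Ω →L[ℝ] ℝ := X.functional J f₀ - innerSL ℝ D ∘L X.gradL Ω
  let ℓ : X Ω → X Ω →L[ℝ] ℝ := fun V => X.functional J (N V) + ℓ₀
  have hD : D =ᵐ[μ] DU₀ := hU₀.grad_memL2.coeFn_toLp
  have hU : U₆ =ᵐ[μ] U₀ := hU₀.memL6.coeFn_toLp
  have hx : x₆ =ᵐ[μ] id := hxm.coeFn_toLp
  have hN : ∀ V, N V =ᵐ[μ] fun x => V.val x + convect x (V.grad x) + F1 U₀ DU₀ V x :=
    nonlinearity_ae hJ hx hU hD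
  have hf₀ : f₀ =ᵐ[μ] fun x => U₀ x + convect x (DU₀ x) - convect (U₀ x) (DU₀ x) := by
    filter_upwards [hD, hU, hx, (hU₀.memL6.mono_exponent three_halves_le_six).coeFn_toLp,
      convectLp_ae x₆ D, convectLp_ae U₆ D, Lp.coeFn_add U₃ (convectLp Ω x₆ D),
      Lp.coeFn_sub (U₃ + convectLp Ω x₆ D) (convectLp Ω U₆ D)] with x h1 h2 h3 h4 h5 h6 h7 h8
    rw [h8, Pi.sub_apply, h7, Pi.add_apply, h4, h5, h6, h1, h2, h3]
    rfl
  have hpair : ∀ (V : X Ω) (ζ : Vec → Vec) (hζ : IsSolenoidalTest Ω ζ),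
      ℓ V (X.ofTest hζ) = pairG Ω U₀ DU₀ V ζ := by
    intro V ζ hζ
    have hval : (X.ofTest hζ).val =ᵐ[μ] ζ := (hζ.test.memLp 2 μ).coeFn_toLp
    have hgrad : (X.ofTest hζ).grad =ᵐ[μ] classicalGrad ζ :=
      (hζ.test.classicalGrad.memLp 2 μ).coeFn_toLp
    have e1 : X.functional J (N V) (X.ofTest hζ) =
        ∫ x in Ω, inner ℝ (V.val x + convect x (V.grad x) + F1 U₀ DU₀ V x) (ζ x) := by
      rw [X.functional_apply hJ]
      refine integral_congr_ae ?_
      filter_upwards [hN V, hval] with x h1 h2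
      rw [h1, h2]
    have e2 : X.functional J f₀ (X.ofTest hζ) =
        ∫ x in Ω, inner ℝ (U₀ x + convect x (DU₀ x) - convect (U₀ x) (DU₀ x)) (ζ x) := by
      rw [X.functional_apply hJ]
      refine integral_congr_ae ?_
      filter_upwards [hf₀, hval] with x h1 h2
      rw [h1, h2]
    have e3 : inner ℝ D (X.ofTest hζ).grad = ∫ x in Ω, inner ℝ (DU₀ x) (classicalGrad ζ x) := by
      rw [L2.inner_def]
      refine integral_congr_ae ?_
      filter_upwards [hD, hgrad] with x h1 h2
      rw [h1, h2]
    change X.functional J (N V) (X.ofTest hζ) + (X.functional J f₀ (X.ofTest hζ) -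
      inner ℝ D (X.ofTest hζ).grad) = _
    rw [e1, e2, e3, pairG, pairF0]
    ring
  have hdir : ∀ (W : X Ω) (ζ : Vec → Vec) (hζ : IsSolenoidalTest Ω ζ),
      X.dirichlet Ω W (X.ofTest hζ) = ∫ x in Ω, inner ℝ (W.grad x) (classicalGrad ζ x) := by
    intro W ζ hζ
    rw [X.dirichlet_apply, L2.inner_def]
    refine integral_congr_ae ?_
    filter_upwards [(hζ.test.classicalGrad.memLp 2 μ).coeFn_toLp] with x h1
    rw [X.ofTest_grad, h1]
  have hNc : Continuous N := continuous_nonlinearity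
  refine ⟨fun V => T (ℓ V), fun V W => ⟨fun hW => ?_, ?_⟩, ?_, fun B hB => ?_⟩
  -- Density of solenoidal test fields upgrades the weak equation to an identity of functionals on
  -- X, which determines `W`.
  · have h1 : X.dirichlet Ω W = ℓ V := X.clm_eq_of_eq_on_tests hΩ fun ζ hζ => by
      rw [hdir, hpair, hW ζ hζ]
    change W = T (ℓ V)
    rw [← h1, hT']
  · rintro rfl ζ hζ
    rw [← hdir _ ζ hζ, hT, hpair]
  · exact hTc.comp (((X.functional J).continuous.comp hNc).add continuous_const)
  · obtain ⟨R, hR⟩ := hB.exists_norm_le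
    obtain ⟨M, hM⟩ := exists_norm_nonlinearity_le (J := J) (x₆ := x₆) (U₆ := U₆) (D := D) R
    obtain ⟨K, hK0, hK⟩ := X.exists_norm_functional_le J
    have hbd : Bornology.IsBounded ((fun V => T (ℓ V)) '' B) := by
      refine isBounded_iff_forall_norm_le.2 ⟨C * (K * M + ‖ℓ₀‖), ?_⟩
      rintro _ ⟨V, hV, rfl⟩
      refine (hC _).trans ?_
      gcongr
      refine (norm_add_le (X.functional J (N V)) ℓ₀).trans (add_le_add ?_ le_rfl)
      exact (hK _).trans (by gcongr; exact hM V (hR V hV))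
    -- Only `N V` varies with `V` and it stays bounded in L^{3/2} on `B`; `ℓ₀` is the common
    -- functional that cancels in differences.
    have htb : TotallyBounded ((fun V => T (ℓ V)) '' B) := by
      refine X.totallyBounded_of_dirichlet_eq hm hΩ.bounded hJ (ℓ := ℓ₀) (M := M) hbd ?_
      rintro _ ⟨V, hV, rfl⟩
      exact ⟨N V, hM V (hR V hV), hT _⟩
    exact htb.closure.isCompact_of_isClosed isClosed_closure
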